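/- Let $\mathcal M$ be a smooth $m$-dimensional Riemannian manifold with metric $g$, and let $\Xi:\mathcal M\to\mathbb R^n$ be an isometric embedding, i.e. a smooth injection such that, in every chart $(U,\Phi)$ with coordinates $x$, writing $y=\Xi\circ\Phi^{-1}(x)$, $M=(\partial y^\alpha/\partial x^i)\in\mathbb R^{n\times m}$ and $G=(g_{ij})$, one has $G=M^\top M$. Let $p:\mathcal M\to\mathbb R$ be a smooth positive function (the target density), $q$ a probability distribution on $\mathcal M$, $K$ a smooth (symmetric positive semidefinite) kernel on $\mathcal M$, and $\mathcal H_K\neq 0$ its reproducing kernel Hilbert space. For a vector field $X$ put $\mathcal J(X)=\mathbb E_q[X[\log p]+\mathrm{div}\,X]$, and assume that $X[\log p]+\mathrm{div}\,X$ is $q$-integrable for every $X=\mathrm{grad}\,f$, $f\in\mathcal H_K$. Define $$\hat f(A')=\mathbb E_{q(A)}\big[(\mathrm{grad}\,K(A,A'))[\log p(A)]+\Delta K(A,A')\big],\qquad \hat X=\mathrm{grad}\,\hat f,$$ where $\Delta=\mathrm{div}\,\mathrm{grad}$, and $\mathrm{grad}$ and $\Delta$ inside the expectation act on the argument $A$.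 Then the following hold. (1) $\hat f$ is a smooth function on $\mathcal M$. If moreover zero is the only locally constant function in $\mathcal H_K$ (for connected $\mathcal M$: the only constant function), so that $\mathfrak X=\{\mathrm{grad}\,f: f\in\mathcal H_K\}$ is a Hilbert space with the norm $\|\mathrm{grad}\,f\|_{\mathfrak X}=\|f\|_{\mathcal H_K}$, then $\hat X$ is the functional gradient: a vector field $X^*$ has the form $X^*=\mathcal J(X^o)X^o$ with $X^o$ a maximizer of $\mathcal J$ over $\{X\in\mathfrak X:\|X\|_{\mathfrak X}=1\}$ if and only if $X^*=\hat X$. (2) Let $\nabla=(\partial_{y^1},\dots,\partial_{y^n})^\top$ be the gradient of $\mathbb R^n$, and let functions on $\mathcal M$, or on a chart domain, be expressed near a point $\Xi(A)$ of $\mathbb R^n$ by any smooth function $h$ on a neighbourhood of $\Xi(A)$ with $h\circ\Xi$ equal to the given function near $A$. For $A\in\mathcal M$ let $N=N(A)\in\mathbb R^{n\times(n-m)}$ be any matrix whose columns form an orthonormal basis of the orthogonal complement of $\Xi_*(T_A\mathcal M)$. Then at every point $A'$, with $N'=N(A')$, $$\Xi_*\hat X=(I_n-N'N'^\top)\nabla\hat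 f .$$ (3) For every $A'$, for every choice, at each $A\in\mathcal M$, of a chart around $A$ (with its $M$ and $G$), of $N(A)$ as above, and of such ambient expressions near $\Xi(A)$ of $\log(p\sqrt{|G|})$, of $K=K(\cdot,A')$ and of the entries of $G^{-1}M^\top$, the integrand below is $q$-integrable in $A$ and $$\hat f(A')=\mathbb E_{q(A)}\Big[\big(\nabla\log(p\sqrt{|G|})\big)^\top(I_n-NN^\top)(\nabla K)+\nabla^\top\nabla K-\mathrm{tr}\big(N^\top(\nabla\nabla^\top K)N\big)+\big((M^\top\nabla)^\top(G^{-1}M^\top)\big)(\nabla K)\Big],$$ where all symbols are evaluated at $\Xi(A)$, and $(M^\top\nabla)^\top(G^{-1}M^\top)$ is the row vector with entries $\sum_{i,\alpha}M_{\alpha i}\,\partial_{y^\alpha}(G^{-1}M^\top)_{i\beta}$. -/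

import Mathlib

open MeasureTheory Topology Matrix
open scoped Manifold ContDiff

namespace RSVGD

/-- A smooth Riemannian metric on an `m`-dimensional smooth manifold. -/
abbrev RiemannMetric (m : ℕ) (M : Type*) [TopologicalSpace M]
    [ChartedSpace (EuclideanSpace ℝ (Fin m)) M] [IsManifold (𝓡 m) ∞ M] :=
  Bundle.ContMDiffRiemannianMetric (𝓡 m) ∞ (EuclideanSpace ℝ (Fin m))
    (fun A : M => TangentSpace (𝓡 m) A)

/-- A positive definite bilinear form on a finite-dimensional space is inverted by
`ContinuousLinearMap.inverse`. -/
theorem apply_inverse_of_pos {E : Type*} [NormedAddCommGroup E] [NormedSpace ℝ E]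
    [FiniteDimensional ℝ E] (b : E →L[ℝ] E →L[ℝ] ℝ) (hb : ∀ v, v ≠ 0 → 0 < b v v)
    (l : E →L[ℝ] ℝ) : b (b.inverse l) = l := by
  have hinj : Function.Injective (b : E →ₗ[ℝ] E →L[ℝ] ℝ) := by
    rw [injective_iff_map_eq_zero]
    intro v hv
    by_contra hne
    have h := hb v hne
    have hv' : b v = 0 := hv
    rw [hv'] at h
    exact lt_irrefl _ h
  have hdim : Module.finrank ℝ E = Module.finrank ℝ (E →L[ℝ] ℝ) := by
    rw [← (LinearMap.toContinuousLinearMap (𝕜 := ℝ) (E := E) (F' := ℝ)).finrank_eq]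
    exact Subspace.dual_finrank_eq.symm
  let e : E ≃L[ℝ] (E →L[ℝ] ℝ) :=
    (LinearEquiv.ofInjectiveOfFinrankEq (b : E →ₗ[ℝ] E →L[ℝ] ℝ) hinj hdim).toContinuousLinearEquiv
  have he : (e : E →L[ℝ] E →L[ℝ] ℝ) = b := rfl
  rw [← he, ContinuousLinearMap.inverse_equiv]
  exact e.apply_symm_apply l

section Riemannian

variable {m : ℕ} {M : Type*} [TopologicalSpace M] [ChartedSpace (EuclideanSpace ℝ (Fin m)) M]

/-- The coordinate vector `∂ᵢ` of the chart `φ`, at the point with coordinates `x`. -/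
noncomputable def coordVec (φ : OpenPartialHomeomorph M (EuclideanSpace ℝ (Fin m)))
    (x : EuclideanSpace ℝ (Fin m)) (i : Fin m) : TangentSpace (𝓡 m) (φ.symm x) :=
  mfderiv (𝓡 m) (𝓡 m) φ.symm x (EuclideanSpace.single i (1 : ℝ))

/-- The `i`-th component `Xⁱ` of a vector field in the chart `φ`, as a function of the
coordinates. -/
noncomputable def component (φ : OpenPartialHomeomorph M (EuclideanSpace ℝ (Fin m)))
    (X : (A : M) → TangentSpace (𝓡 m) A) (i : Fin m) (x : EuclideanSpace ℝ (Fin m)) : ℝ :=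
  (show EuclideanSpace ℝ (Fin m) from
    mfderiv (𝓡 m) (𝓡 m) φ (φ.symm x) (X (φ.symm x))) i

/-- The directional derivative `X[f]` of a function along a vector field. -/
noncomputable def dirDeriv (X : (A : M) → TangentSpace (𝓡 m) A) (f : M → ℝ) (A : M) : ℝ :=
  mfderiv (𝓡 m) 𝓘(ℝ, ℝ) f A (X A)

variable [IsManifold (𝓡 m) ∞ M]

/-- The matrix `G = (gᵢⱼ)` of the metric in the chart `φ`, as a function of the coordinates. -/
noncomputable def metricMatrix (g : RiemannMetric m M)
    (φ : OpenPartialHomeomorph M (EuclideanSpace ℝ (Fin m))) (x : EuclideanSpace ℝ (Fin m)) :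
    Matrix (Fin m) (Fin m) ℝ :=
  Matrix.of fun i j => g.inner (φ.symm x) (coordVec φ x i) (coordVec φ x j)

/-- The Riemannian gradient: `grad f (A)` is the vector `v` with `g_A(v, ·) = df_A`
(see `inner_grad`). -/
noncomputable def grad (g : RiemannMetric m M) (f : M → ℝ) (A : M) : TangentSpace (𝓡 m) A :=
  (g.inner A).inverse (mfderiv (𝓡 m) 𝓘(ℝ, ℝ) f A)

/-- The divergence computed in the chart `φ`: `∂ᵢ(√|G| Xⁱ) / √|G|`. -/
noncomputable def chartDiv (g : RiemannMetric m M)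
    (φ : OpenPartialHomeomorph M (EuclideanSpace ℝ (Fin m)))
    (X : (A : M) → TangentSpace (𝓡 m) A) (x : EuclideanSpace ℝ (Fin m)) : ℝ :=
  (∑ i, fderiv ℝ (fun z => √(metricMatrix g φ z).det * component φ X i z) x
    (EuclideanSpace.single i (1 : ℝ))) / √(metricMatrix g φ x).det

/-- The divergence of a vector field, computed at each point `A` in the preferred chart at `A`
(for smooth fields every chart around `A` gives the same value). -/
noncomputable def div (g : RiemannMetric m M) (X : (A : M) → TangentSpace (𝓡 m) A) (A : M) : ℝ :=
  chartDiv g (chartAt (EuclideanSpace ℝ (Fin m)) A) X (chartAt (EuclideanSpace ℝ (Fin m)) A A)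

/-- The Laplace-Beltrami operator. -/
noncomputable def laplaceBeltrami (g : RiemannMetric m M) (f : M → ℝ) (A : M) : ℝ :=
  div g (grad g f) A

/-- The integrand `X[log p] + div X` of the objective (the generalized Stein operator). -/
noncomputable def stein (g : RiemannMetric m M) (p : M → ℝ)
    (X : (A : M) → TangentSpace (𝓡 m) A) (A : M) : ℝ :=
  dirDeriv X (fun B => Real.log (p B)) A + div g X A

/-- The objective `𝒥(X) = 𝔼_q [X[log p] + div X]`. -/
noncomputable def objective [MeasurableSpace M] (g : RiemannMetric m M) (p : M → ℝ)
    (q : Measure M) (X : (A : M) → TangentSpace (𝓡 m) A) : ℝ :=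
  ∫ A, stein g p X A ∂q

/-- `X` is a unit vector of the space `𝔛 = {grad f | f ∈ H}`, which carries the norm of `H`
transported along `f ↦ grad f` (a bijection from `H` onto `𝔛` when zero is the only element of `H`
that is locally constant). -/
def IsUnitField (g : RiemannMetric m M) (H : Type*) [NormedAddCommGroup H]
    [InnerProductSpace ℝ H] [RKHS ℝ H M ℝ] (X : (A : M) → TangentSpace (𝓡 m) A) : Prop :=
  ∃ f : H, ‖f‖ = 1 ∧ X = grad g f

/-- `X` is a functional gradient: `X = 𝒥(X°) X°` for a maximizer `X°` of the objective over the
unit vectors of `𝔛 = {grad f | f ∈ H}`. -/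
def IsFunctionalGradient [MeasurableSpace M] (g : RiemannMetric m M) (p : M → ℝ)
    (q : Measure M) (H : Type*) [NormedAddCommGroup H] [InnerProductSpace ℝ H] [RKHS ℝ H M ℝ]
    (X : (A : M) → TangentSpace (𝓡 m) A) : Prop :=
  ∃ X₀ : (A : M) → TangentSpace (𝓡 m) A, IsUnitField g H X₀ ∧
    (∀ Y, IsUnitField g H Y → objective g p q Y ≤ objective g p q X₀) ∧
    X = fun A => objective g p q X₀ • X₀ A

/-- The function `f̂(A') = 𝔼_{q(A)} [(grad K(A, A'))[log p(A)] + Δ K(A, A')]`, where `grad` and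
`Δ` act on the argument `A`. -/
noncomputable def fHat [MeasurableSpace M] (g : RiemannMetric m M) (p : M → ℝ)
    (q : Measure M) (K : M → M → ℝ) (A' : M) : ℝ :=
  ∫ A, (dirDeriv (grad g fun B => K B A') (fun B => Real.log (p B)) A
    + laplaceBeltrami g (fun B => K B A') A) ∂q

/-- The defining property of the Riemannian gradient. -/
theorem inner_grad (g : RiemannMetric m M) (f : M → ℝ) (A : M) (w : TangentSpace (𝓡 m) A) :
    g.inner A (grad g f A) w = mfderiv (𝓡 m) 𝓘(ℝ, ℝ) f A w := by
  exact DFunLike.congr_fun (apply_inverse_of_pos (E := EuclideanSpace ℝ (Fin m)) (g.inner A)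
    (g.pos A) (mfderiv (𝓡 m) 𝓘(ℝ, ℝ) f A)) w

end Riemannian

section Embedded

variable {m n : ℕ} {M : Type*} [TopologicalSpace M] [ChartedSpace (EuclideanSpace ℝ (Fin m)) M]

/-- The matrix `M_{αi} = ∂y^α/∂xⁱ` of the embedding `y = Ξ ∘ φ⁻¹` in the chart `φ`, as a function
of the coordinates. -/
noncomputable def jacobian (Ξ : M → EuclideanSpace ℝ (Fin n))
    (φ : OpenPartialHomeomorph M (EuclideanSpace ℝ (Fin m))) (x : EuclideanSpace ℝ (Fin m)) :
    Matrix (Fin n) (Fin m) ℝ :=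
  Matrix.of fun α i => fderiv ℝ (Ξ ∘ φ.symm) x (EuclideanSpace.single i (1 : ℝ)) α

/-- An isometric embedding: a smooth injection such that `g_{ij} = ∑_α ∂ᵢy^α ∂ⱼy^α` in every chart
of the maximal smooth atlas. -/
structure IsIsometricEmbedding [IsManifold (𝓡 m) ∞ M] (g : RiemannMetric m M)
    (Ξ : M → EuclideanSpace ℝ (Fin n)) : Prop where
  smooth : ContMDiff (𝓡 m) (𝓡 n) ∞ Ξ
  injective : Function.Injective Ξ
  isometric : ∀ φ ∈ IsManifold.maximalAtlas (𝓡 m) ∞ M, ∀ x ∈ φ.target,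
    metricMatrix g φ x = (jacobian Ξ φ x)ᵀ * jacobian Ξ φ x

/-- The push-forward `Ξ_* X(A) ∈ ℝⁿ` of a vector field at the point `A`. -/
noncomputable def pushforward (Ξ : M → EuclideanSpace ℝ (Fin n))
    (X : (A : M) → TangentSpace (𝓡 m) A) (A : M) : EuclideanSpace ℝ (Fin n) :=
  mfderiv (𝓡 m) (𝓡 n) Ξ A (X A)

/-- The push-forward `Ξ_*(T_A M)` of the tangent space at `A`, as a subspace of `ℝⁿ`. -/
noncomputable def tangentImage (m : ℕ) {M : Type*} [TopologicalSpace M]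
    [ChartedSpace (EuclideanSpace ℝ (Fin m)) M] (Ξ : M → EuclideanSpace ℝ (Fin n)) (A : M) :
    Submodule ℝ (EuclideanSpace ℝ (Fin n)) :=
  LinearMap.range (mfderiv (𝓡 m) (𝓡 n) Ξ A :
    EuclideanSpace ℝ (Fin m) →L[ℝ] EuclideanSpace ℝ (Fin n)).toLinearMap

/-- The columns of `N` form an orthonormal basis of the orthogonal complement of `Ξ_*(T_A M)`. -/
def IsNormalBasis (Ξ : M → EuclideanSpace ℝ (Fin n)) (A : M)
    (N : Matrix (Fin n) (Fin (n - m)) ℝ) : Prop :=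
  Orthonormal ℝ (fun k => (WithLp.toLp 2 (N.col k) : EuclideanSpace ℝ (Fin n))) ∧
    Submodule.span ℝ
      (Set.range fun k => (WithLp.toLp 2 (N.col k) : EuclideanSpace ℝ (Fin n))) =
      (tangentImage m Ξ A)ᗮ

/-- `h` is an expression of `f ∘ Ξ⁻¹` in the ambient space around `Ξ A`: it is smooth around
`Ξ A`, and `h ∘ Ξ = f` around `A`. -/
def IsAmbientExpr (Ξ : M → EuclideanSpace ℝ (Fin n)) (A : M) (f : M → ℝ)
    (h : EuclideanSpace ℝ (Fin n) → ℝ) : Prop :=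
  ContDiffAt ℝ ∞ h (Ξ A) ∧ ∀ᶠ B in 𝓝 A, h (Ξ B) = f B

/-- The ambient gradient `∇h = (∂_{y¹} h, …, ∂_{yⁿ} h)`. -/
noncomputable def ambGrad (h : EuclideanSpace ℝ (Fin n) → ℝ) (y : EuclideanSpace ℝ (Fin n)) :
    Fin n → ℝ :=
  fun α => fderiv ℝ h y (EuclideanSpace.single α (1 : ℝ))

/-- The ambient Hessian `∇∇ᵀh`; its trace is `∇ᵀ∇h`. -/
noncomputable def ambHess (h : EuclideanSpace ℝ (Fin n) → ℝ) (y : EuclideanSpace ℝ (Fin n)) :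
    Matrix (Fin n) (Fin n) ℝ :=
  Matrix.of fun α β => ambGrad (fun z => ambGrad h z β) y α

/-- The row vector `(Mᵀ∇)ᵀ W`, with entries `∑ᵢ ∑_α M_{αi} ∂_α W_{iβ}`, at the point `y`. -/
noncomputable def rowDiv (J : Matrix (Fin n) (Fin m) ℝ)
    (W : EuclideanSpace ℝ (Fin n) → Matrix (Fin m) (Fin n) ℝ) (y : EuclideanSpace ℝ (Fin n)) :
    Fin n → ℝ :=
  fun β => ∑ i, ∑ α, J α i * ambGrad (fun z => W z i β) y α

/-- The integrand of the embedded formula at the point `y`: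
`(∇L)ᵀ(I - NNᵀ)∇k + ∇ᵀ∇k - tr(Nᵀ(∇∇ᵀk)N) + ((Jᵀ∇)ᵀW)∇k`. -/
noncomputable def embIntegrand (J : Matrix (Fin n) (Fin m) ℝ)
    (N : Matrix (Fin n) (Fin (n - m)) ℝ) (L k : EuclideanSpace ℝ (Fin n) → ℝ)
    (W : EuclideanSpace ℝ (Fin n) → Matrix (Fin m) (Fin n) ℝ) (y : EuclideanSpace ℝ (Fin n)) : ℝ :=
  ambGrad L y ⬝ᵥ ((1 - N * Nᵀ) *ᵥ ambGrad k y)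
    + (ambHess k y).trace - (Nᵀ * ambHess k y * N).trace
    + rowDiv J W y ⬝ᵥ ambGrad k y

end Embedded

end RSVGD

/-! Write ψ(A) for the kernel section K(·, A) as a vector of H. Since f(A) = ⟨ψ(A), f⟩,
differentiating f amounts to differentiating ψ, provided ψ is smooth as an H-valued map in charts.
That follows from smoothness of K alone: the Gram function ⟨ψ(z), ψ(w)⟩ controls the norms of linear
combinations of increments of ψ (`differentiableAt_of_contDiffAt_inner`,
`contDiffOn_of_contDiffOn_inner`). Hence every f in H is smooth, and the integrand (grad f)[log p] +
Δf at A equals ⟨s(A), f⟩ for some s(A) in H (`exists_stein_grad_eq_inner`).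

Each ⟨s(·), f⟩ is integrable, so the closed graph theorem makes f ↦ 𝒥(grad f) bounded, and Riesz
gives 𝒥(grad f) = ⟨F, f⟩ (`exists_inner_eq_integral`). Taking f = ψ(A') yields f̂(A') = F(A'). So f̂
is the element F of H and is smooth without any differentiation under the integral sign. Maximizing
⟨F, ·⟩ on the unit sphere is the equality case of Cauchy–Schwarz (`inner_smul_eq_of_isMax`).

The embedded formulas are pointwise. The vector ∇h − Ξ_* grad f is normal to the tangent image, and
I − NNᵀ is the tangential projection (`pushforward_grad`). For the integrand, the components of grad
f are the entries of (G⁻¹Mᵀ)∇k along the embedding; the product rule and MG⁻¹Mᵀ = I − NNᵀ give the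
four terms (`stein_grad_eq_embIntegrand`). Because `div` uses one preferred chart at each point
while the formula allows any chart, chart independence is also needed; it comes from writing the
divergence as a tangential trace (`coordinate_div_eq_trace`, `trace_inv_mul_change`). -/

namespace RSVGD

/-! ### Smoothness of a Hilbert-space-valued map from smoothness of its kernel -/

section FeatureMap

variable {E H : Type*} [NormedAddCommGroup E] [NormedSpace ℝ E]
  [NormedAddCommGroup H] [InnerProductSpace ℝ H]

/-- If the kernel of a feature map `ψ` is `C²` at `(x, x)`, then its second differences are
approximated by a bilinear form. -/
theorem exists_bilinear_approx_inner_sub {ψ : E → H} {x : E}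
    (hk : ContDiffAt ℝ 2 (fun z : E × E => inner ℝ (ψ z.1) (ψ z.2)) (x, x)) :
    ∃ B : E →L[ℝ] E →L[ℝ] ℝ, ∀ ε > 0, ∃ δ > 0, ∀ h h' : E, ‖h‖ < δ → ‖h'‖ < δ →
      |inner ℝ (ψ (x + h) - ψ x) (ψ (x + h') - ψ x) - B h h'| ≤ ε * (‖h‖ * ‖h'‖) := by
  set k : E × E → ℝ := fun z => inner ℝ (ψ z.1) (ψ z.2) with hkdef
  -- `D` is the derivative in the second variable, and the bilinear form is its derivative in the
  -- first. Strict differentiability bounds D(x+h, x+v) − D(x, x+v) − B h by ε‖h‖ uniformly in small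
  -- v; the mean value inequality in v then supplies the factor ‖h'‖.
  let D : E × E → E →L[ℝ] ℝ := fun z => (fderiv ℝ k z).comp (.inr ℝ E E)
  have hD : ContDiffAt ℝ 1 D (x, x) :=
    (hk.fderiv_right (m := 1) (by norm_num)).clm_comp contDiffAt_const
  have hDs := hD.hasStrictFDerivAt one_ne_zero
  refine ⟨(fderiv ℝ D (x, x)).comp (.inl ℝ E E), fun ε hε => ?_⟩
  have hdiff : ∀ᶠ z in 𝓝 (x, x), DifferentiableAt ℝ k z := by
    filter_upwards [hk.eventually (by simp)] with z hz
    exact hz.differentiableAt (by norm_num)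
  obtain ⟨δ₁, hδ₁, H₁⟩ := Metric.eventually_nhds_iff_ball.1 hdiff
  obtain ⟨δ₂, hδ₂, H₂⟩ := Metric.eventually_nhds_iff_ball.1 (hDs.isLittleO.def hε)
  have mem : ∀ {δ : ℝ} {u v : E}, ‖u‖ < δ → ‖v‖ < δ → (x + u, x + v) ∈ Metric.ball (x, x) δ := by
    intro δ u v hu hv
    simp [Metric.mem_ball, dist_eq_norm, hu, hv]
  refine ⟨min δ₁ δ₂, lt_min hδ₁ hδ₂, fun h h' hh hh' => ?_⟩
  have h0 : ‖(0 : E)‖ < min δ₁ δ₂ := by simpa using ⟨hδ₁, hδ₂⟩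
  set B := (fderiv ℝ D (x, x)).comp (.inl ℝ E E) with hB
  have key := (convex_ball (0 : E) (min δ₁ δ₂)).norm_image_sub_le_of_norm_hasFDerivWithin_le
    (f := fun v => k (x + h, x + v) - k (x, x + v) - B h v)
    (f' := fun v => D (x + h, x + v) - D (x, x + v) - B h) (C := ε * ‖h‖) (x := 0) (y := h')
    (fun v hv => ?_) (fun v hv => ?_) (by simpa using ⟨hδ₁, hδ₂⟩) (by simpa using hh')
  · have e : inner ℝ (ψ (x + h) - ψ x) (ψ (x + h') - ψ x) - B h h' =
        (k (x + h, x + h') - k (x, x + h') - B h h') - (k (x + h, x + 0) - k (x, x + 0) - B h 0) := by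
      simp only [hkdef, inner_sub_left, inner_sub_right, add_zero, map_zero]
      ring
    rw [e]
    simpa [mul_assoc] using key
  · have hv' : ‖v‖ < min δ₁ δ₂ := by simpa using hv
    have step : ∀ u : E, ‖u‖ < min δ₁ δ₂ →
        HasFDerivAt (fun v => k (x + u, x + v)) (D (x + u, x + v)) v := by
      intro u hu
      have hd : HasFDerivAt k (fderiv ℝ k (x + u, x + v)) (x + u, x + v) :=
        (H₁ _ (mem (hu.trans_le (min_le_left _ _)) (hv'.trans_le (min_le_left _ _)))).hasFDerivAt
      have hi : HasFDerivAt (fun v : E => (x + u, x + v)) (ContinuousLinearMap.inr ℝ E E) v := by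
        exact (hasFDerivAt_const (x + u) v).prodMk ((hasFDerivAt_id v).const_add x)
      exact hd.comp v hi
    have s0 := step 0 h0
    rw [add_zero] at s0
    exact (((step h hh).sub s0).sub (B h).hasFDerivAt).hasFDerivWithinAt
  · have hv' : ‖v‖ < min δ₁ δ₂ := by simpa using hv
    have := H₂ ((x + h, x + v), (x + 0, x + v)) (by
      have a := mem (hh.trans_le (min_le_right _ _)) (hv'.trans_le (min_le_right _ _))
      have b := mem (h0.trans_le (min_le_right _ _)) (hv'.trans_le (min_le_right _ _))
      rw [← ball_prod_same]
      exact ⟨a, b⟩)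
    simpa [hB] using this

/-- The second differences of the feature map control linear relations between increments. -/
theorem norm_sum_smul_sub_sq_le {ι : Type*} [Fintype ι] {ψ : E → H} {x : E}
    {B : E →L[ℝ] E →L[ℝ] ℝ} {ε δ : ℝ}
    (hB : ∀ h h' : E, ‖h‖ < δ → ‖h'‖ < δ →
      |inner ℝ (ψ (x + h) - ψ x) (ψ (x + h') - ψ x) - B h h'| ≤ ε * (‖h‖ * ‖h'‖))
    (c : ι → ℝ) (h : ι → E) (hδ : ∀ i, ‖h i‖ < δ) (h0 : ∑ i, c i • h i = 0) :
    ‖∑ i, c i • (ψ (x + h i) - ψ x)‖ ^ 2 ≤ ε * (∑ i, |c i| * ‖h i‖) ^ 2 := by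
  -- The relation ∑ cᵢhᵢ = 0 kills the bilinear part, so expanding the squared norm leaves only the
  -- approximation errors.
  have hB0 : ∑ i, ∑ j, c i * c j * B (h i) (h j) = 0 := by
    have : B (∑ i, c i • h i) (∑ j, c j • h j) = 0 := by simp [h0]
    rw [← this]
    simp only [map_sum, map_smul, _root_.sum_apply, _root_.smul_apply,
      smul_eq_mul, Finset.mul_sum]
    rw [Finset.sum_comm]
    refine Finset.sum_congr rfl fun i _ => Finset.sum_congr rfl fun j _ => ?_
    ring
  calc ‖∑ i, c i • (ψ (x + h i) - ψ x)‖ ^ 2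
      = ∑ i, ∑ j, c i * c j * (inner ℝ (ψ (x + h i) - ψ x) (ψ (x + h j) - ψ x) -
          B (h i) (h j)) := by
        simp only [mul_sub, Finset.sum_sub_distrib, hB0]
        rw [← real_inner_self_eq_norm_sq, sum_inner, sub_zero]
        refine Finset.sum_congr rfl fun i _ => ?_
        rw [inner_sum]
        refine Finset.sum_congr rfl fun j _ => ?_
        rw [real_inner_smul_left, real_inner_smul_right]
        simp only [inner_sub_left, inner_sub_right]
        ring
    _ ≤ ∑ i, ∑ j, |c i| * |c j| * (ε * (‖h i‖ * ‖h j‖)) := by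
        refine Finset.sum_le_sum fun i _ => Finset.sum_le_sum fun j _ => ?_
        refine (le_abs_self _).trans ?_
        rw [abs_mul, abs_mul]
        exact mul_le_mul_of_nonneg_left (hB _ _ (hδ i) (hδ j)) (by positivity)
    _ = ε * (∑ i, |c i| * ‖h i‖) ^ 2 := by
        rw [sq, Finset.sum_mul_sum, Finset.mul_sum]
        refine Finset.sum_congr rfl fun i _ => ?_
        rw [Finset.mul_sum]
        refine Finset.sum_congr rfl fun j _ => ?_
        ring

/-- A feature map whose kernel is `C²` at `(x, x)` is differentiable at `x`. -/
theorem differentiableAt_of_contDiffAt_inner [FiniteDimensional ℝ E] [CompleteSpace H]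
    {ψ : E → H} {x : E}
    (hk : ContDiffAt ℝ 2 (fun z : E × E => inner ℝ (ψ z.1) (ψ z.2)) (x, x)) :
    DifferentiableAt ℝ ψ x := by
  obtain ⟨B, hB⟩ := exists_bilinear_approx_inner_sub hk
  let Δ : E → H := fun h => ψ (x + h) - ψ x
  -- linear relations between small increments hold up to a small error
  have rel : ∀ ε > 0, ∃ δ > 0, ∀ (c : Fin 3 → ℝ) (h : Fin 3 → E), (∀ i, ‖h i‖ < δ) →
      ∑ i, c i • h i = 0 → ‖∑ i, c i • Δ (h i)‖ ≤ ε * ∑ i, |c i| * ‖h i‖ := by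
    intro ε hε
    obtain ⟨δ, hδ, H⟩ := hB (ε ^ 2) (by positivity)
    refine ⟨δ, hδ, fun c h hh h0 => ?_⟩
    refine le_of_sq_le_sq ?_ (by positivity)
    rw [mul_pow]
    exact norm_sum_smul_sub_sq_le H c h hh h0
  -- The derivative is the limit of the difference quotients `u h n` with step 1/(n+1), the shift
  -- keeping the scale positive at n = 0. Existence, additivity, homogeneity and first-order
  -- approximation are all relations among at most three increments, padded with zero where needed;
  -- hence `Fin 3` in `rel`.
  let t : ℕ → ℝ := fun n => (n : ℝ) + 1
  have tpos : ∀ n, 0 < t n := fun n => by positivity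
  let u : E → ℕ → H := fun h n => t n • Δ ((t n)⁻¹ • h)
  have small : ∀ δ > 0, ∀ h : E, ∀ᶠ n in Filter.atTop, ‖(t n)⁻¹ • h‖ < δ := by
    intro δ hδ h
    have h1 : Filter.Tendsto (fun n => ‖(t n)⁻¹ • h‖) Filter.atTop (𝓝 0) := by
      have : Filter.Tendsto (fun n => (t n)⁻¹) Filter.atTop (𝓝 0) :=
        (Filter.tendsto_atTop_add_const_right _ _ tendsto_natCast_atTop_atTop).inv_tendsto_atTop
      simpa using (this.smul_const h).norm
    exact h1.eventually (gt_mem_nhds hδ)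
  have nrm : ∀ n (h : E), |t n| * ‖(t n)⁻¹ • h‖ = ‖h‖ := by
    intro n h
    rw [norm_smul, norm_inv, Real.norm_eq_abs, ← mul_assoc,
      mul_inv_cancel₀ (abs_pos.2 (tpos n).ne').ne', one_mul]
  have canc : ∀ n (h : E), t n • (t n)⁻¹ • h = h := fun n h => smul_inv_smul₀ (tpos n).ne' h
  have cauchy : ∀ h, CauchySeq (u h) := by
    intro h
    rw [Metric.cauchySeq_iff]
    intro ε hε
    -- The two quotients contribute total weight 2‖h‖; the +1 makes the final inequality strict and
    -- covers h = 0.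
    obtain ⟨δ, hδ, H⟩ := rel (ε / (2 * (‖h‖ + 1))) (by positivity)
    obtain ⟨n₀, hn₀⟩ := Filter.eventually_atTop.1 (small δ hδ h)
    refine ⟨n₀, fun a ha b hb => ?_⟩
    have := H ![t a, -t b, 0] ![(t a)⁻¹ • h, (t b)⁻¹ • h, 0]
      (by
        intro i
        fin_cases i
        · exact hn₀ a ha
        · exact hn₀ b hb
        · simpa using hδ)
      (by simp [Fin.sum_univ_three, canc])
    simp only [Fin.sum_univ_three, Matrix.cons_val, zero_smul, abs_neg, nrm, norm_zero, mul_zero,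
      add_zero, neg_smul, ← sub_eq_add_neg] at this
    rw [dist_eq_norm]
    refine this.trans_lt ?_
    rw [div_mul_eq_mul_div, div_lt_iff₀ (by positivity)]
    nlinarith [norm_nonneg h]
  choose L hL using fun h => cauchySeq_tendsto_of_complete (cauchy h)
  have zero_of : ∀ (v : ℕ → H) (l : H) (C : ℝ), 0 ≤ C → Filter.Tendsto v Filter.atTop (𝓝 l) →
      (∀ ε > 0, ∀ᶠ n in Filter.atTop, ‖v n‖ ≤ ε * C) → l = 0 := by
    intro v l C hC hv hb
    rw [← norm_le_zero_iff]
    refine le_of_forall_pos_le_add fun ε hε => ?_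
    refine le_of_tendsto hv.norm ?_
    filter_upwards [hb (ε / (C + 1)) (by positivity)] with n hn
    refine hn.trans ?_
    rw [zero_add, div_mul_eq_mul_div, div_le_iff₀ (by positivity)]
    nlinarith
  have Ladd : ∀ h h', L (h + h') = L h + L h' := by
    intro h h'
    rw [← sub_eq_zero]
    refine zero_of _ _ (‖h + h'‖ + ‖h‖ + ‖h'‖) (by positivity)
      ((hL (h + h')).sub ((hL h).add (hL h'))) fun ε hε => ?_
    obtain ⟨δ, hδ, H⟩ := rel ε hε
    filter_upwards [small δ hδ h, small δ hδ h', small δ hδ (h + h')] with n h1 h2 h3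
    have := H ![t n, -t n, -t n] ![(t n)⁻¹ • (h + h'), (t n)⁻¹ • h, (t n)⁻¹ • h']
      (by
        intro i
        fin_cases i
        · exact h3
        · exact h1
        · exact h2)
      (by simp [Fin.sum_univ_three, -smul_add, canc])
    simp only [Fin.sum_univ_three, Matrix.cons_val, abs_neg, nrm] at this
    refine le_trans (le_of_eq ?_) this
    simp only [u]
    congr 1
    module
  have Lsmul : ∀ (a : ℝ) h, L (a • h) = a • L h := by
    intro a h
    rw [← sub_eq_zero]
    refine zero_of _ _ (‖a • h‖ + |a| * ‖h‖) (by positivity)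
      ((hL (a • h)).sub ((hL h).const_smul a)) fun ε hε => ?_
    obtain ⟨δ, hδ, H⟩ := rel ε hε
    filter_upwards [small δ hδ h, small δ hδ (a • h)] with n h1 h2
    have := H ![t n, -(a * t n), 0] ![(t n)⁻¹ • (a • h), (t n)⁻¹ • h, 0]
      (by
        intro i
        fin_cases i
        · exact h2
        · exact h1
        · simpa using hδ)
      (by simp [Fin.sum_univ_three, canc, mul_smul])
    simp only [Fin.sum_univ_three, Matrix.cons_val, abs_neg, nrm, abs_mul a, mul_assoc, zero_smul,
      norm_zero, mul_zero, add_zero] at this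
    refine le_trans (le_of_eq ?_) this
    simp only [u]
    congr 1
    module
  -- Finite dimension of `E` makes this linear limit continuous.
  let Ll : E →ₗ[ℝ] H := { toFun := L, map_add' := Ladd, map_smul' := Lsmul }
  refine ⟨LinearMap.toContinuousLinearMap Ll, ?_⟩
  rw [hasFDerivAt_iff_isLittleO_nhds_zero, Asymptotics.isLittleO_iff]
  intro ε hε
  obtain ⟨δ, hδ, H⟩ := rel (ε / 2) (by positivity)
  filter_upwards [Metric.ball_mem_nhds (0 : E) hδ] with h hh
  have hh : ‖h‖ < δ := by simpa using hh
  change ‖ψ (x + h) - ψ x - L h‖ ≤ ε * ‖h‖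
  refine le_of_tendsto (((tendsto_const_nhds (x := Δ h)).sub (hL h)).norm) ?_
  filter_upwards [small δ hδ h] with n hn
  have := H ![1, -t n, 0] ![h, (t n)⁻¹ • h, 0]
    (by
      intro i
      fin_cases i
      · exact hh
      · exact hn
      · simpa using hδ)
    (by simp [Fin.sum_univ_three, canc])
  simp only [Fin.sum_univ_three, Matrix.cons_val, abs_neg, nrm, one_smul, abs_one, one_mul,
    zero_smul, norm_zero, mul_zero, add_zero, neg_smul, ← sub_eq_add_neg] at this
  refine this.trans (le_of_eq ?_)
  ring

/-- A feature map with smooth kernel on an open set is smooth there. -/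
theorem contDiffOn_of_contDiffOn_inner [FiniteDimensional ℝ E] [CompleteSpace H]
    {U : Set E} (hU : IsOpen U) (r : ℕ) {ψ : E → H}
    (hk : ContDiffOn ℝ ∞ (fun z : E × E => inner ℝ (ψ z.1) (ψ z.2)) (U ×ˢ U)) :
    ContDiffOn ℝ r ψ U := by
  induction r generalizing ψ with
  | zero =>
    rw [Nat.cast_zero, contDiffOn_zero]
    intro x hx
    exact (differentiableAt_of_contDiffAt_inner
      ((hk.contDiffAt ((hU.prod hU).mem_nhds ⟨hx, hx⟩)).of_le
        (mod_cast le_top : ((2 : ℕ∞) : WithTop ℕ∞) ≤ ∞))).continuousAt.continuousWithinAt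
  | succ r ih =>
    have hd : ∀ x ∈ U, DifferentiableAt ℝ ψ x := fun x hx =>
      differentiableAt_of_contDiffAt_inner
        ((hk.contDiffAt ((hU.prod hU).mem_nhds ⟨hx, hx⟩)).of_le
          (mod_cast le_top : ((2 : ℕ∞) : WithTop ℕ∞) ≤ ∞))
    rw [Nat.cast_succ]
    refine contDiffOn_succ_of_fderiv_apply (fun x hx => (hd x hx).differentiableWithinAt)
      (by simp) fun e => ?_
    -- The Gram function of z ↦ Dψ(z)e is the mixed derivative of that of ψ along (e, 0) and then
    -- (0, e). It is again smooth, so the induction hypothesis applies to the differentiated map.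
    have hcongr : ContDiffOn ℝ r (fun x => fderiv ℝ ψ x e) U := by
      refine ih ?_
      have hUU := hU.prod hU
      have step : ∀ (k : E × E → ℝ) (v : E × E), ContDiffOn ℝ ∞ k (U ×ˢ U) →
          ContDiffOn ℝ ∞ (fun z => fderiv ℝ k z v) (U ×ˢ U) := fun k v h =>
        (h.fderiv_of_isOpen (m := ∞) hUU (by simp)).clm_apply contDiffOn_const
      have h1 : ContDiffOn ℝ ∞ (fun z : E × E => inner ℝ (fderiv ℝ ψ z.1 e) (ψ z.2)) (U ×ˢ U) := by
        refine (step _ (e, 0) hk).congr fun z hz => ?_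
        have a := (hd _ hz.1).hasFDerivAt.comp z hasFDerivAt_fst
        have b := (hd _ hz.2).hasFDerivAt.comp z hasFDerivAt_snd
        have c := (a.inner ℝ b).fderiv
        simp only [Function.comp_def] at c
        rw [c]
        simp
      refine (step _ (0, e) h1).congr ?_
      rintro ⟨z₁, z₂⟩ hz
      -- Dψ(z)e is not yet known to be differentiable in z, so the product rule is unavailable
      -- jointly. Joint differentiability comes from `h1`; the value along (0, e) is found with z₁
      -- frozen.
      have a : HasFDerivAt (fun w : E => inner ℝ (fderiv ℝ ψ z₁ e) (ψ w))
          ((innerSL ℝ (fderiv ℝ ψ z₁ e)).comp (fderiv ℝ ψ z₂)) z₂ :=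
        (innerSL ℝ (fderiv ℝ ψ z₁ e)).hasFDerivAt.comp z₂ (hd _ hz.2).hasFDerivAt
      have hdz : DifferentiableAt ℝ (fun z : E × E => inner ℝ (fderiv ℝ ψ z.1 e) (ψ z.2))
          (z₁, z₂) := (h1.contDiffAt (hUU.mem_nhds hz)).differentiableAt (by simp)
      have b := hdz.hasFDerivAt.comp z₂ (hasFDerivAt_prodMk_right z₁ z₂)
      simpa using congrArg (fun T : E →L[ℝ] ℝ => T e) (a.unique b)
    exact hcongr.congr fun x hx => by rw [fderivWithin_of_isOpen hU hx]

end FeatureMap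

/-! ### Two analytic tools: weak integration and the derivative of a determinant -/

/-- A linear family of integrable functions, each value of which depends continuously on the
parameter, has an integral that depends continuously on the parameter: it is represented by a
vector. -/
theorem exists_inner_eq_integral {Ω H : Type*} [MeasurableSpace Ω] {q : Measure Ω}
    [NormedAddCommGroup H] [InnerProductSpace ℝ H] [CompleteSpace H] (s : Ω → H)
    (hs : ∀ f : H, Integrable (fun A => inner ℝ (s A) f) q) :
    ∃ F : H, ∀ f : H, ∫ A, inner ℝ (s A) f ∂q = inner ℝ F f := by
  let T : H →ₗ[ℝ] Lp ℝ 1 q :=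
    { toFun := fun f => (hs f).toL1 _
      map_add' := fun f f' => by
        rw [← Integrable.toL1_add]
        congr 1
        ext A
        simp [inner_add_right]
      map_smul' := fun c f => by
        rw [RingHom.id_apply, ← Integrable.toL1_smul]
        congr 1
        ext A
        simp [inner_smul_right] }
  -- The graph is closed: an L¹-convergent sequence converges almost everywhere along a subsequence,
  -- while ⟨s(A), uᵢ⟩ → ⟨s(A), x⟩ at every A. No integrability of ‖s‖ is required.
  have hT : ∀ (u : ℕ → H) (x : H) (y : Lp ℝ 1 q), Filter.Tendsto u Filter.atTop (𝓝 x) →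
      Filter.Tendsto (T ∘ u) Filter.atTop (𝓝 y) → y = T x := by
    intro u x y hu hy
    obtain ⟨ns, hns, hae⟩ := (tendstoInMeasure_of_tendsto_Lp hy).exists_seq_tendsto_ae
    refine Lp.ext ?_
    have h1 : ∀ᵐ A ∂q, ∀ i, (T (u (ns i)) : Ω → ℝ) A = inner ℝ (s A) (u (ns i)) :=
      ae_all_iff.2 fun i => (hs (u (ns i))).coeFn_toL1
    filter_upwards [hae, h1, (hs x).coeFn_toL1] with A h2 h3 h4
    refine tendsto_nhds_unique h2 ?_
    change Filter.Tendsto (fun i => (T (u (ns i)) : Ω → ℝ) A) _ (𝓝 ((T x : Ω → ℝ) A))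
    simp only [h3]
    rw [show (T x : Ω → ℝ) A = inner ℝ (s A) x from h4]
    exact (tendsto_const_nhds.inner (hu.comp hns.tendsto_atTop))
  let T' : H →L[ℝ] Lp ℝ 1 q := ContinuousLinearMap.ofSeqClosedGraph hT
  refine ⟨(InnerProductSpace.toDual ℝ H).symm ((L1.integralCLM).comp T'), fun f => ?_⟩
  rw [InnerProductSpace.toDual_symm_apply]
  change _ = L1.integralCLM (T f)
  rw [← L1.integral_of_fun_eq_integral (hs f), ← L1.integral_eq_integral]
  exact L1.integral_eq (T f)

/-- Jacobi's formula for the derivative of a determinant. -/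
theorem hasFDerivAt_det {ι E : Type*} [Fintype ι] [DecidableEq ι] [NormedAddCommGroup E]
    [NormedSpace ℝ E] {G : E → Matrix ι ι ℝ} {G' : ι → ι → E →L[ℝ] ℝ} {x : E}
    (hG : ∀ i j, HasFDerivAt (fun z => G z i j) (G' i j) x) :
    HasFDerivAt (fun z => (G z).det) (∑ i, ∑ j, (G x).adjugate j i • G' i j) x := by
  -- The determinant is multilinear in the rows, so its derivative replaces one row at a time;
  -- Cramer's rule turns each resulting determinant into a sum of adjugate entries.
  let D : ContinuousMultilinearMap ℝ (fun _ : ι => ι → ℝ) ℝ :=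
    { (Matrix.detRowAlternating : (ι → ℝ) [⋀^ι]→ₗ[ℝ] ℝ).toMultilinearMap with
      cont := by
        change Continuous fun A : Matrix ι ι ℝ => A.det
        fun_prop }
  have h1 : HasFDerivAt (fun z => (fun i j => G z i j : ι → ι → ℝ))
      (ContinuousLinearMap.pi fun i => ContinuousLinearMap.pi fun j => G' i j) x :=
    hasFDerivAt_pi.2 fun i => hasFDerivAt_pi.2 fun j => hG i j
  have h2 := (D.hasFDerivAt (fun i j => G x i j)).comp x h1
  refine h2.congr_fderiv ?_
  ext v
  simp only [ContinuousLinearMap.comp_apply, ContinuousMultilinearMap.linearDeriv_apply,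
    _root_.sum_apply, _root_.smul_apply, smul_eq_mul]
  refine Finset.sum_congr rfl fun i _ => ?_
  change ((G x).updateRow i fun j => G' i j v).det = _
  have := Matrix.cramer_transpose_apply (G x) (fun j => G' i j v) i
  rw [← this, Matrix.cramer_eq_adjugate_mulVec, ← Matrix.adjugate_transpose]
  rfl

/-! ### Divergence as a tangential trace, in coordinates -/

section Euclidean

variable {m n : ℕ}

/-- The matrix of partial derivatives of a map between Euclidean spaces. -/
noncomputable def partialMatrix (f : EuclideanSpace ℝ (Fin m) → EuclideanSpace ℝ (Fin n))
    (x : EuclideanSpace ℝ (Fin m)) : Matrix (Fin n) (Fin m) ℝ :=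
  Matrix.of fun α i => fderiv ℝ f x (EuclideanSpace.single i (1 : ℝ)) α

theorem sum_smul_single (v : EuclideanSpace ℝ (Fin m)) :
    ∑ i, v i • EuclideanSpace.single i (1 : ℝ) = v := by
  ext j
  simp [Finset.sum_apply, Pi.single_apply]

theorem map_eq_sum_single {F : Type*} [NormedAddCommGroup F] [NormedSpace ℝ F]
    (T : EuclideanSpace ℝ (Fin m) →L[ℝ] F) (v : EuclideanSpace ℝ (Fin m)) :
    T v = ∑ i, v i • T (EuclideanSpace.single i (1 : ℝ)) := by
  conv_lhs => rw [← sum_smul_single v]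
  simp

theorem fderiv_eq_sum_ambGrad (h : EuclideanSpace ℝ (Fin n) → ℝ) (y v : EuclideanSpace ℝ (Fin n)) :
    fderiv ℝ h y v = ∑ α, v α * ambGrad h y α := by
  rw [map_eq_sum_single]
  rfl

theorem partialMatrix_comp {f : EuclideanSpace ℝ (Fin m) → EuclideanSpace ℝ (Fin n)}
    {τ : EuclideanSpace ℝ (Fin m) → EuclideanSpace ℝ (Fin m)} {x : EuclideanSpace ℝ (Fin m)}
    (hf : DifferentiableAt ℝ f (τ x)) (hτ : DifferentiableAt ℝ τ x) :
    partialMatrix (f ∘ τ) x = partialMatrix f (τ x) * partialMatrix τ x := by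
  ext α i
  simp only [partialMatrix, Matrix.of_apply, Matrix.mul_apply]
  rw [fderiv_comp x hf hτ, ContinuousLinearMap.comp_apply, map_eq_sum_single (fderiv ℝ f (τ x))]
  simp [mul_comm]

/-- The divergence of a tangential field, computed in coordinates, is the tangential trace of its
ambient derivative. -/
theorem coordinate_div_eq_trace {Y : EuclideanSpace ℝ (Fin m) → EuclideanSpace ℝ (Fin n)}
    {G : EuclideanSpace ℝ (Fin m) → Matrix (Fin m) (Fin m) ℝ}
    {c : Fin m → EuclideanSpace ℝ (Fin m) → ℝ} {x : EuclideanSpace ℝ (Fin m)}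
    (hY : ContDiffAt ℝ 2 Y x) (hG : ∀ᶠ z in 𝓝 x, G z = (partialMatrix Y z)ᵀ * partialMatrix Y z)
    (hdet : 0 < (G x).det) (hc : ∀ i, DifferentiableAt ℝ (c i) x) :
    (∑ i, fderiv ℝ (fun z => √(G z).det * c i z) x (EuclideanSpace.single i (1 : ℝ))) /
        √(G x).det =
      ((G x)⁻¹ * ((partialMatrix Y x)ᵀ * partialMatrix (fun z => ∑ k, c k z •
        fderiv ℝ Y z (EuclideanSpace.single k (1 : ℝ))) x)).trace := by
  let e : Fin m → EuclideanSpace ℝ (Fin m) := fun i => EuclideanSpace.single i (1 : ℝ)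
  have hGx := hG.self_of_nhds
  have hDY : DifferentiableAt ℝ (fderiv ℝ Y) x :=
    (hY.fderiv_right (m := 1) (by norm_num)).differentiableAt one_ne_zero
  let S : Fin m → Fin m → EuclideanSpace ℝ (Fin n) := fun i k => fderiv ℝ (fderiv ℝ Y) x (e i) (e k)
  have hS : ∀ i k, S i k = S k i := fun i k => by
    have := hY.isSymmSndFDerivAt (by simp)
    exact this.eq _ _
  let y : Fin m → EuclideanSpace ℝ (Fin n) := fun i => fderiv ℝ Y x (e i)
  have hYk : ∀ k, HasFDerivAt (fun z => fderiv ℝ Y z (e k))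
      ((fderiv ℝ (fderiv ℝ Y) x).flip (e k)) x := fun k => by
    simpa using hDY.hasFDerivAt.clm_apply (hasFDerivAt_const (e k) x)
  have inner_sum_coord : ∀ u v : EuclideanSpace ℝ (Fin n), inner ℝ u v = ∑ α, u α * v α :=
    fun u v => by simp [PiLp.inner_apply, mul_comm]
  have hGe : ∀ᶠ z in 𝓝 x, ∀ i j, G z i j = inner ℝ (fderiv ℝ Y z (e i)) (fderiv ℝ Y z (e j)) := by
    filter_upwards [hG] with z hz i j
    rw [hz, inner_sum_coord]
    rfl
  -- derivative of the metric
  have hG' : ∀ i j, HasFDerivAt (fun z => G z i j)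
      (fderiv ℝ (fun z => G z i j) x) x ∧ ∀ k, fderiv ℝ (fun z => G z i j) x (e k) =
        inner ℝ (y i) (S k j) + inner ℝ (S k i) (y j) := by
    intro i j
    have h1 := ((hYk i).inner ℝ (hYk j)).congr_of_eventuallyEq (f₁ := fun z => G z i j)
      (hGe.mono fun z hz => hz i j)
    refine ⟨h1.differentiableAt.hasFDerivAt, fun k => ?_⟩
    rw [h1.fderiv]
    simp [S, y]
  have hGsymm : ∀ i j, (G x)⁻¹ i j = (G x)⁻¹ j i := by
    intro i j
    have : ((G x)⁻¹)ᵀ = (G x)⁻¹ := by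
      rw [Matrix.transpose_nonsing_inv, hGx, Matrix.transpose_mul, Matrix.transpose_transpose]
    exact congrFun (congrFun this j) i
  have hunit : IsUnit (G x).det := hdet.ne'.isUnit
  have hdet' := hasFDerivAt_det fun i j => (hG' i j).1
  have hsqrt := hdet'.sqrt hdet.ne'
  -- Jacobi's formula gives ∂ₖ log √|G| as half the trace of G⁻¹∂ₖG. Since G = JᵀJ, this is the
  -- contraction of G⁻¹ with ⟨∂ⱼY, ∂ᵢ∂ₖY⟩, which is what differentiating the basis fields
  -- contributes to the trace.
  have hlog : ∀ k, fderiv ℝ (fun z => √(G z).det) x (e k) =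
      √(G x).det * ∑ i, ∑ j, (G x)⁻¹ i j * inner ℝ (y j) (S i k) := by
    intro k
    have hadj : ∀ i j, (G x).adjugate j i = (G x).det * (G x)⁻¹ i j := by
      intro i j
      rw [hGsymm, Matrix.inv_def, Matrix.smul_apply, smul_eq_mul, Ring.inverse_eq_inv',
        mul_inv_cancel_left₀ hdet.ne']
    -- The two product-rule terms agree by symmetry of G⁻¹ and of second derivatives; their factor 2
    -- cancels the 1/2 from the square root.
    have e1 : ∑ i, ∑ j, (G x)⁻¹ i j * (inner ℝ (y i) (S k j) + inner ℝ (S k i) (y j)) =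
        2 * ∑ i, ∑ j, (G x)⁻¹ i j * inner ℝ (y j) (S i k) := by
      simp only [mul_add, Finset.sum_add_distrib, two_mul]
      congr 1
      · rw [Finset.sum_comm]
        refine Finset.sum_congr rfl fun i _ => Finset.sum_congr rfl fun j _ => ?_
        rw [hGsymm, hS]
      · refine Finset.sum_congr rfl fun i _ => Finset.sum_congr rfl fun j _ => ?_
        rw [real_inner_comm, hS]
    rw [hsqrt.fderiv]
    simp only [_root_.smul_apply, _root_.sum_apply, smul_eq_mul, (hG' _ _).2, hadj, mul_assoc]
    simp only [← Finset.mul_sum, e1]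
    have hs : √(G x).det * √(G x).det = (G x).det := Real.mul_self_sqrt hdet.le
    have hs0 : √(G x).det ≠ 0 := (Real.sqrt_pos.2 hdet).ne'
    field_simp
    rw [sq, hs]
  have hV : ∀ i, fderiv ℝ (fun z => ∑ k, c k z • fderiv ℝ Y z (e k)) x (e i) =
      ∑ k, (c k x • S i k + fderiv ℝ (c k) x (e i) • y k) := by
    intro i
    have : HasFDerivAt (fun z => ∑ k, c k z • fderiv ℝ Y z (e k)) _ x :=
      HasFDerivAt.fun_sum fun k _ => (hc k).hasFDerivAt.smul (hYk k)
    rw [this.fderiv]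
    simp [S, y]
  have hGy : ∀ j k, inner ℝ (y j) (y k) = G x j k := fun j k => (hGe.self_of_nhds j k).symm
  have hr : ((G x)⁻¹ * ((partialMatrix Y x)ᵀ * partialMatrix (fun z => ∑ k, c k z •
        fderiv ℝ Y z (EuclideanSpace.single k (1 : ℝ))) x)).trace =
      ∑ i, ∑ j, (G x)⁻¹ i j * inner ℝ (y j) (∑ k, (c k x • S i k + fderiv ℝ (c k) x (e i) • y k)) := by
    simp only [Matrix.trace, Matrix.diag_apply]
    refine Finset.sum_congr rfl fun i _ => ?_
    rw [Matrix.mul_apply]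
    refine Finset.sum_congr rfl fun j _ => ?_
    rw [← hV, inner_sum_coord, Matrix.mul_apply]
    rfl
  have hfirst : ∀ i k, ∑ j, (G x)⁻¹ i j * inner ℝ (y j) (y k) = if i = k then 1 else 0 := by
    intro i k
    simp only [hGy]
    rw [← Matrix.mul_apply, Matrix.nonsing_inv_mul _ hunit, Matrix.one_apply]
  have hs0 : √(G x).det ≠ 0 := (Real.sqrt_pos.2 hdet).ne'
  have hl : ∀ i, fderiv ℝ (fun z => √(G z).det * c i z) x (e i) =
      √(G x).det * (fderiv ℝ (c i) x (e i) +
        ∑ i', ∑ j, (G x)⁻¹ i' j * (c i x * inner ℝ (y j) (S i' i))) := by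
    intro i
    rw [(hsqrt.differentiableAt.hasFDerivAt.fun_mul (hc i).hasFDerivAt).fderiv]
    simp only [_root_.add_apply, _root_.smul_apply, smul_eq_mul]
    rw [hlog i, mul_add]
    congr 1
    rw [mul_left_comm, Finset.mul_sum]
    congr 1
    refine Finset.sum_congr rfl fun i' _ => ?_
    rw [Finset.mul_sum]
    refine Finset.sum_congr rfl fun j _ => ?_
    ring
  change (∑ i, fderiv ℝ (fun z => √(G z).det * c i z) x (e i)) / √(G x).det = _
  rw [hr]
  simp only [hl, ← Finset.mul_sum]
  rw [mul_div_cancel_left₀ _ hs0]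
  simp only [inner_sum, inner_add_right, real_inner_smul_right, Finset.mul_sum, mul_add,
    Finset.sum_add_distrib]
  rw [add_comm]
  congr 1
  · rw [Finset.sum_comm]
    refine Finset.sum_congr rfl fun i _ => ?_
    rw [Finset.sum_comm]
  · symm
    calc ∑ i, ∑ j, ∑ k, (G x)⁻¹ i j * (fderiv ℝ (c k) x (e i) * inner ℝ (y j) (y k))
        = ∑ i, ∑ k, fderiv ℝ (c k) x (e i) * ∑ j, (G x)⁻¹ i j * inner ℝ (y j) (y k) := by
          refine Finset.sum_congr rfl fun i _ => ?_
          rw [Finset.sum_comm]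
          refine Finset.sum_congr rfl fun k _ => ?_
          rw [Finset.mul_sum]
          refine Finset.sum_congr rfl fun j _ => ?_
          ring
      _ = _ := by simp [hfirst]

/-- The tangential trace does not depend on the coordinates. -/
theorem trace_inv_mul_change (J D : Matrix (Fin n) (Fin m) ℝ) (T : Matrix (Fin m) (Fin m) ℝ)
    (hT : IsUnit T.det) :
    (((J * T)ᵀ * (J * T))⁻¹ * ((J * T)ᵀ * (D * T))).trace = ((Jᵀ * J)⁻¹ * (Jᵀ * D)).trace := by
  have hT' : IsUnit (Tᵀ).det := by rwa [Matrix.det_transpose]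
  have e : (J * T)ᵀ * (J * T) = Tᵀ * (Jᵀ * J) * T := by
    simp only [Matrix.transpose_mul, Matrix.mul_assoc]
  rw [e, Matrix.mul_inv_rev, Matrix.mul_inv_rev, Matrix.transpose_mul]
  -- The factors of Tᵀ cancel, leaving a conjugate by `T`, invisible to the trace.
  have : T⁻¹ * ((Jᵀ * J)⁻¹ * Tᵀ⁻¹) * (Tᵀ * Jᵀ * (D * T)) =
      T⁻¹ * ((Jᵀ * J)⁻¹ * (Jᵀ * D)) * T := by
    simp only [Matrix.mul_assoc]
    rw [Matrix.nonsing_inv_mul_cancel_left _ _ hT']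
  rw [this, Matrix.trace_mul_cycle, Matrix.mul_nonsing_inv _ hT, Matrix.one_mul]

end Euclidean

/-! ### Vector fields and the metric in a chart of the maximal atlas -/

section Chart

variable {m n : ℕ} {M : Type*} [TopologicalSpace M] [ChartedSpace (EuclideanSpace ℝ (Fin m)) M]
  {φ : OpenPartialHomeomorph M (EuclideanSpace ℝ (Fin m))}

theorem mdifferentiableAt_symm_of_mem_maximalAtlas
    (hφ : φ ∈ IsManifold.maximalAtlas (𝓡 m) ∞ M) {x : EuclideanSpace ℝ (Fin m)}
    (hx : x ∈ φ.target) : MDifferentiableAt (𝓡 m) (𝓡 m) φ.symm x :=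
  (contMDiffAt_symm_of_mem_maximalAtlas hφ hx).mdifferentiableAt (by simp)

theorem contDiffOn_comp_symm
    (hφ : φ ∈ IsManifold.maximalAtlas (𝓡 m) ∞ M)
    {F : Type*} [NormedAddCommGroup F] [NormedSpace ℝ F] {f : M → F}
    (hf : ContMDiff (𝓡 m) 𝓘(ℝ, F) ∞ f) : ContDiffOn ℝ ∞ (f ∘ φ.symm) φ.target :=
  (hf.comp_contMDiffOn (contMDiffOn_symm_of_mem_maximalAtlas hφ)).contDiffOn

theorem mfderiv_symm_sum_single {x : EuclideanSpace ℝ (Fin m)} (c : Fin m → ℝ) :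
    mfderiv (𝓡 m) (𝓡 m) φ.symm x
      (∑ i, c i • EuclideanSpace.single i (1 : ℝ) : EuclideanSpace ℝ (Fin m)) =
      ∑ i, c i • coordVec φ x i := by
  erw [map_sum]
  refine Finset.sum_congr rfl fun i _ => ?_
  erw [map_smul]
  rfl

theorem mdifferentiable_of_mem_maximalAtlas
    (hφ : φ ∈ IsManifold.maximalAtlas (𝓡 m) ∞ M) : φ.MDifferentiable (𝓡 m) (𝓡 m) :=
  ⟨fun _ hA => ((contMDiffAt_of_mem_maximalAtlas hφ hA).mdifferentiableAt
    (by simp)).mdifferentiableWithinAt,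
   fun _ hx => (mdifferentiableAt_symm_of_mem_maximalAtlas hφ hx).mdifferentiableWithinAt⟩

theorem fderiv_comp_symm
    (hφ : φ ∈ IsManifold.maximalAtlas (𝓡 m) ∞ M)
    {F : Type*} [NormedAddCommGroup F] [NormedSpace ℝ F] {f : M → F}
    {x : EuclideanSpace ℝ (Fin m)} (hx : x ∈ φ.target)
    (hf : MDifferentiableAt (𝓡 m) 𝓘(ℝ, F) f (φ.symm x)) (v : EuclideanSpace ℝ (Fin m)) :
    fderiv ℝ (f ∘ φ.symm) x v =
      mfderiv (𝓡 m) 𝓘(ℝ, F) f (φ.symm x) (mfderiv (𝓡 m) (𝓡 m) φ.symm x v) := by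
  rw [← mfderiv_eq_fderiv,
    mfderiv_comp x hf (mdifferentiableAt_symm_of_mem_maximalAtlas hφ hx)]
  rfl

theorem mfderiv_symm_mfderiv
    (hφ : φ ∈ IsManifold.maximalAtlas (𝓡 m) ∞ M) {x : EuclideanSpace ℝ (Fin m)} (hx : x ∈ φ.target)
    (v : TangentSpace (𝓡 m) (φ.symm x)) :
    mfderiv (𝓡 m) (𝓡 m) φ.symm x (show EuclideanSpace ℝ (Fin m) from
      mfderiv (𝓡 m) (𝓡 m) φ (φ.symm x) v) = v := by
  have h := (mdifferentiable_of_mem_maximalAtlas hφ).symm_comp_deriv (φ.map_target hx)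
  rw [φ.right_inv hx] at h
  exact DFunLike.congr_fun h v

theorem mfderiv_mfderiv_symm
    (hφ : φ ∈ IsManifold.maximalAtlas (𝓡 m) ∞ M) {x : EuclideanSpace ℝ (Fin m)} (hx : x ∈ φ.target)
    (v : EuclideanSpace ℝ (Fin m)) :
    mfderiv (𝓡 m) (𝓡 m) φ (φ.symm x) (mfderiv (𝓡 m) (𝓡 m) φ.symm x v) = v :=
  DFunLike.congr_fun ((mdifferentiable_of_mem_maximalAtlas hφ).comp_symm_deriv hx) v

/-- A vector field is the combination of the coordinate fields with its components. -/
theorem eq_mfderiv_symm_component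
    (hφ : φ ∈ IsManifold.maximalAtlas (𝓡 m) ∞ M) {x : EuclideanSpace ℝ (Fin m)} (hx : x ∈ φ.target)
    (X : (A : M) → TangentSpace (𝓡 m) A) :
    X (φ.symm x) = mfderiv (𝓡 m) (𝓡 m) φ.symm x
      (∑ i, component φ X i x • EuclideanSpace.single i (1 : ℝ) : EuclideanSpace ℝ (Fin m)) := by
  have : (∑ i, component φ X i x • EuclideanSpace.single i (1 : ℝ) : EuclideanSpace ℝ (Fin m)) =
      mfderiv (𝓡 m) (𝓡 m) φ (φ.symm x) (X (φ.symm x)) := sum_smul_single (m := m) _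
  rw [this]
  exact (mfderiv_symm_mfderiv hφ hx _).symm

theorem mfderiv_apply_eq_sum_component
    (hφ : φ ∈ IsManifold.maximalAtlas (𝓡 m) ∞ M) {F : Type*} [NormedAddCommGroup F] [NormedSpace ℝ F]
    {f : M → F} {x : EuclideanSpace ℝ (Fin m)} (hx : x ∈ φ.target)
    (hf : MDifferentiableAt (𝓡 m) 𝓘(ℝ, F) f (φ.symm x)) (X : (A : M) → TangentSpace (𝓡 m) A) :
    mfderiv (𝓡 m) 𝓘(ℝ, F) f (φ.symm x) (X (φ.symm x)) =
      (∑ i, component φ X i x • fderiv ℝ (f ∘ φ.symm) x (EuclideanSpace.single i (1 : ℝ)) : F) := by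
  rw [eq_mfderiv_symm_component hφ hx X, ← fderiv_comp_symm hφ hx hf]
  simp only [map_sum, map_smul]
  rfl

variable [IsManifold (𝓡 m) ∞ M] {g : RiemannMetric m M}

theorem metricMatrix_mulVec {x : EuclideanSpace ℝ (Fin m)} (c : Fin m → ℝ) (j : Fin m) :
    (metricMatrix g φ x *ᵥ c) j = g.inner (φ.symm x) (coordVec φ x j)
      (mfderiv (𝓡 m) (𝓡 m) φ.symm x
        (∑ i, c i • EuclideanSpace.single i (1 : ℝ) : EuclideanSpace ℝ (Fin m))) := by
  rw [mfderiv_symm_sum_single, map_sum]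
  simp [Matrix.mulVec, dotProduct, metricMatrix, mul_comm]

/-- The matrix is positive definite: its quadratic form at c is g(v, v), with v the image of c under
the differential of the inverse chart, and that differential is injective. -/
theorem metricMatrix_det_pos
    (hφ : φ ∈ IsManifold.maximalAtlas (𝓡 m) ∞ M) {x : EuclideanSpace ℝ (Fin m)} (hx : x ∈ φ.target) :
    0 < (metricMatrix g φ x).det := by
  refine Matrix.PosDef.det_pos (Matrix.PosDef.of_dotProduct_mulVec_pos ?_ fun c hc => ?_)
  · ext i j
    simp [metricMatrix, g.symm]
  · let v : EuclideanSpace ℝ (Fin m) := WithLp.toLp 2 c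
    have hv : v ≠ 0 := by
      intro h
      apply hc
      ext i
      exact congrFun (congrArg WithLp.ofLp h) i
    have hv' : (∑ i, c i • EuclideanSpace.single i (1 : ℝ) : EuclideanSpace ℝ (Fin m)) = v :=
      sum_smul_single v
    have hq : star c ⬝ᵥ (metricMatrix g φ x *ᵥ c) = g.inner (φ.symm x)
        (mfderiv (𝓡 m) (𝓡 m) φ.symm x v) (mfderiv (𝓡 m) (𝓡 m) φ.symm x v) := by
      simp only [dotProduct, metricMatrix_mulVec, star_trivial]
      rw [← hv']
      conv_rhs => enter [1]; rw [mfderiv_symm_sum_single, map_sum]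
      rw [_root_.sum_apply]
      simp
    rw [hq]
    refine g.pos _ _ fun h0 => hv ?_
    rw [← mfderiv_mfderiv_symm hφ hx v, h0]
    exact map_zero _

/-- The components of a gradient. -/
theorem component_grad
    (hφ : φ ∈ IsManifold.maximalAtlas (𝓡 m) ∞ M) {f : M → ℝ} {x : EuclideanSpace ℝ (Fin m)} (hx : x ∈ φ.target)
    (hf : MDifferentiableAt (𝓡 m) 𝓘(ℝ, ℝ) f (φ.symm x)) (i : Fin m) :
    component φ (grad g f) i x = ∑ j, (metricMatrix g φ x)⁻¹ i j *
      fderiv ℝ (f ∘ φ.symm) x (EuclideanSpace.single j (1 : ℝ)) := by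
  have h : metricMatrix g φ x *ᵥ (fun i => component φ (grad g f) i x) =
      fun j => fderiv ℝ (f ∘ φ.symm) x (EuclideanSpace.single j (1 : ℝ)) := by
    ext j
    rw [metricMatrix_mulVec, ← eq_mfderiv_symm_component hφ hx, g.symm, inner_grad,
      fderiv_comp_symm hφ hx hf]
    rfl
  have h2 := congrArg (fun v => ((metricMatrix g φ x)⁻¹ *ᵥ v) i) h
  simp only [Matrix.mulVec_mulVec] at h2
  rw [Matrix.nonsing_inv_mul _ (metricMatrix_det_pos hφ hx).ne'.isUnit, Matrix.one_mulVec] at h2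
  exact h2

theorem contDiffOn_det {ι E : Type*} [Fintype ι] [DecidableEq ι] [NormedAddCommGroup E]
    [NormedSpace ℝ E] {G : E → Matrix ι ι ℝ} {U : Set E}
    (hG : ∀ i j, ContDiffOn ℝ ∞ (fun z => G z i j) U) :
    ContDiffOn ℝ ∞ (fun z => (G z).det) U := by
  simp only [Matrix.det_apply']
  exact ContDiffOn.sum fun σ _ => contDiffOn_const.mul (contDiffOn_prod fun i _ => hG _ _)

/-- Cramer's rule: each entry is a cofactor divided by the determinant. -/
theorem contDiffOn_inv_apply {ι E : Type*} [Fintype ι] [DecidableEq ι] [NormedAddCommGroup E]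
    [NormedSpace ℝ E] {G : E → Matrix ι ι ℝ} {U : Set E}
    (hG : ∀ i j, ContDiffOn ℝ ∞ (fun z => G z i j) U) (hdet : ∀ z ∈ U, (G z).det ≠ 0) (i j : ι) :
    ContDiffOn ℝ ∞ (fun z => (G z)⁻¹ i j) U := by
  simp only [Matrix.inv_def, Matrix.smul_apply, smul_eq_mul, Ring.inverse_eq_inv',
    Matrix.adjugate_apply]
  refine ((contDiffOn_det hG).inv hdet).mul (contDiffOn_det fun a b => ?_)
  simp only [Matrix.updateRow_apply]
  split_ifs
  · exact contDiffOn_const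
  · exact hG a b

end Chart

/-! ### Isometric embeddings and chart independence of the divergence -/

section Embedding

variable {m n : ℕ} {M : Type*} [TopologicalSpace M] [ChartedSpace (EuclideanSpace ℝ (Fin m)) M]
  [IsManifold (𝓡 m) ∞ M] {φ : OpenPartialHomeomorph M (EuclideanSpace ℝ (Fin m))}
  {g : RiemannMetric m M} {Ξ : M → EuclideanSpace ℝ (Fin n)}

/-- The isometry condition writes the entries as inner products of the smooth fields ∂ᵢy, so the
smooth structure of the metric bundle need not be unfolded. -/
theorem IsIsometricEmbedding.contDiffOn_metricMatrix (hΞ : IsIsometricEmbedding g Ξ)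
    (hφ : φ ∈ IsManifold.maximalAtlas (𝓡 m) ∞ M) (i j : Fin m) :
    ContDiffOn ℝ ∞ (fun z => metricMatrix g φ z i j) φ.target := by
  have hY := contDiffOn_comp_symm hφ hΞ.smooth
  have hD : ∀ i, ContDiffOn ℝ ∞
      (fun z => fderiv ℝ (Ξ ∘ φ.symm) z (EuclideanSpace.single i (1 : ℝ))) φ.target := fun i =>
    (hY.fderiv_of_isOpen (m := ∞) φ.open_target (by simp)).clm_apply contDiffOn_const
  refine ((hD i).inner ℝ (hD j)).congr fun z hz => ?_
  rw [hΞ.isometric φ hφ z hz, Matrix.mul_apply]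
  simp [jacobian, PiLp.inner_apply, mul_comm]

theorem IsIsometricEmbedding.contDiffOn_component_grad (hΞ : IsIsometricEmbedding g Ξ)
    (hφ : φ ∈ IsManifold.maximalAtlas (𝓡 m) ∞ M) {f : M → ℝ}
    (hf : ContMDiff (𝓡 m) 𝓘(ℝ, ℝ) ∞ f) (i : Fin m) :
    ContDiffOn ℝ ∞ (component φ (grad g f) i) φ.target := by
  have hD : ∀ i, ContDiffOn ℝ ∞
      (fun z => fderiv ℝ (f ∘ φ.symm) z (EuclideanSpace.single i (1 : ℝ))) φ.target := fun i =>
    ((contDiffOn_comp_symm hφ hf).fderiv_of_isOpen (m := ∞) φ.open_target (by simp)).clm_apply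
      contDiffOn_const
  refine ContDiffOn.congr (f := fun z => ∑ j, (metricMatrix g φ z)⁻¹ i j *
      fderiv ℝ (f ∘ φ.symm) z (EuclideanSpace.single j (1 : ℝ))) ?_ fun z hz =>
    component_grad hφ hz (hf.mdifferentiableAt (by simp)) i
  exact ContDiffOn.sum fun j _ => (contDiffOn_inv_apply (hΞ.contDiffOn_metricMatrix hφ)
    (fun z hz => (metricMatrix_det_pos hφ hz).ne') i j).mul (hD j)

theorem pushforward_eq_sum_component (hΞ : IsIsometricEmbedding g Ξ)
    (hφ : φ ∈ IsManifold.maximalAtlas (𝓡 m) ∞ M) (X : (A : M) → TangentSpace (𝓡 m) A)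
    {x : EuclideanSpace ℝ (Fin m)} (hx : x ∈ φ.target) :
    pushforward Ξ X (φ.symm x) = ∑ k, component φ X k x •
      fderiv ℝ (Ξ ∘ φ.symm) x (EuclideanSpace.single k (1 : ℝ)) :=
  mfderiv_apply_eq_sum_component hφ hx (hΞ.smooth.mdifferentiableAt (by simp)) X

theorem partialMatrix_congr {f f' : EuclideanSpace ℝ (Fin m) → EuclideanSpace ℝ (Fin n)}
    {x : EuclideanSpace ℝ (Fin m)} (h : f =ᶠ[𝓝 x] f') : partialMatrix f x = partialMatrix f' x := by
  simp only [partialMatrix, h.fderiv_eq]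

/-- The divergence in a chart is the tangential trace of the derivative of the push-forward. -/
theorem IsIsometricEmbedding.chartDiv_eq_trace (hΞ : IsIsometricEmbedding g Ξ)
    (hφ : φ ∈ IsManifold.maximalAtlas (𝓡 m) ∞ M) {X : (A : M) → TangentSpace (𝓡 m) A}
    {x : EuclideanSpace ℝ (Fin m)} (hx : x ∈ φ.target)
    (hX : ∀ i, DifferentiableAt ℝ (component φ X i) x) :
    chartDiv g φ X x = (((jacobian Ξ φ x)ᵀ * jacobian Ξ φ x)⁻¹ * ((jacobian Ξ φ x)ᵀ *
      partialMatrix (fun z => pushforward Ξ X (φ.symm z)) x)).trace := by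
  have hY : ContDiffAt ℝ 2 (Ξ ∘ φ.symm) x :=
    ((contDiffOn_comp_symm hφ hΞ.smooth).contDiffAt (φ.open_target.mem_nhds hx)).of_le
      (mod_cast le_top : ((2 : ℕ∞) : WithTop ℕ∞) ≤ ∞)
  have hT : ∀ᶠ z in 𝓝 x, z ∈ φ.target := φ.open_target.mem_nhds hx
  rw [← hΞ.isometric φ hφ x hx, partialMatrix_congr
    (hT.mono fun z hz => pushforward_eq_sum_component hΞ hφ X hz)]
  exact coordinate_div_eq_trace hY (hT.mono fun z hz => hΞ.isometric φ hφ z hz)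
    (metricMatrix_det_pos hφ hx) hX

/-- The divergence of a vector field does not depend on the chart. -/
theorem IsIsometricEmbedding.chartDiv_eq_chartDiv (hΞ : IsIsometricEmbedding g Ξ)
    {φ' : OpenPartialHomeomorph M (EuclideanSpace ℝ (Fin m))}
    (hφ : φ ∈ IsManifold.maximalAtlas (𝓡 m) ∞ M) (hφ' : φ' ∈ IsManifold.maximalAtlas (𝓡 m) ∞ M)
    {X : (A : M) → TangentSpace (𝓡 m) A} {A : M} (hA : A ∈ φ.source) (hA' : A ∈ φ'.source)
    (hX : ∀ i, DifferentiableAt ℝ (component φ X i) (φ A))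
    (hX' : ∀ i, DifferentiableAt ℝ (component φ' X i) (φ' A)) :
    chartDiv g φ' X (φ' A) = chartDiv g φ X (φ A) := by
  have hx := φ.map_source hA
  have hx' := φ'.map_source hA'
  rw [hΞ.chartDiv_eq_trace hφ hx hX, hΞ.chartDiv_eq_trace hφ' hx' hX']
  -- In the trace form, both the Jacobian of Ξ and the derivative of the pushed-forward field change
  -- by right multiplication by the matrix of the transition map τ.
  let τ : EuclideanSpace ℝ (Fin m) → EuclideanSpace ℝ (Fin m) := φ ∘ φ'.symm
  have hτx : τ (φ' A) = φ A := by simp [τ, φ'.left_inv hA']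
  have hτ : DifferentiableAt ℝ τ (φ' A) := by
    have h1 : ContMDiffAt (𝓡 m) (𝓡 m) ∞ φ (φ'.symm (φ' A)) := by
      rw [φ'.left_inv hA']
      exact contMDiffAt_of_mem_maximalAtlas hφ hA
    exact (h1.comp _ (contMDiffAt_symm_of_mem_maximalAtlas hφ' hx')).contDiffAt.differentiableAt
      (by simp)
  have hev : ∀ᶠ z in 𝓝 (φ' A), φ.symm (τ z) = φ'.symm z := by
    have hc : ContinuousAt φ'.symm (φ' A) := φ'.continuousAt_symm hx'
    have : φ.source ∈ 𝓝 (φ'.symm (φ' A)) := by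
      rw [φ'.left_inv hA']
      exact φ.open_source.mem_nhds hA
    filter_upwards [hc.eventually_mem this] with z hz
    exact φ.left_inv hz
  have hchange : ∀ V : M → EuclideanSpace ℝ (Fin n), DifferentiableAt ℝ (V ∘ φ.symm) (φ A) →
      partialMatrix (V ∘ φ'.symm) (φ' A) =
        partialMatrix (V ∘ φ.symm) (φ A) * partialMatrix τ (φ' A) := by
    intro V hV
    rw [← hτx, ← partialMatrix_comp (by rwa [hτx]) hτ]
    refine partialMatrix_congr (hev.mono fun z hz => ?_)
    simp only [Function.comp_apply] at hz ⊢
    rw [hz]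
  have hYd : ∀ z ∈ φ.target, ContDiffAt ℝ ∞ (Ξ ∘ φ.symm) z := fun z hz =>
    (contDiffOn_comp_symm hφ hΞ.smooth).contDiffAt (φ.open_target.mem_nhds hz)
  have hJ : jacobian Ξ φ' (φ' A) = jacobian Ξ φ (φ A) * partialMatrix τ (φ' A) :=
    hchange Ξ ((hYd _ hx).differentiableAt (by simp))
  have hV : DifferentiableAt ℝ ((pushforward Ξ X) ∘ φ.symm) (φ A) := by
    have h1 : DifferentiableAt ℝ (fun z => ∑ k, component φ X k z •
        fderiv ℝ (Ξ ∘ φ.symm) z (EuclideanSpace.single k (1 : ℝ))) (φ A) := by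
      refine DifferentiableAt.fun_sum fun k _ => (hX k).fun_smul ?_
      exact (((hYd _ hx).fderiv_right (m := 1)
        (mod_cast le_top : ((2 : ℕ∞) : WithTop ℕ∞) ≤ ∞)).differentiableAt one_ne_zero).clm_apply
        (differentiableAt_const _)
    refine h1.congr_of_eventuallyEq ?_
    filter_upwards [φ.open_target.mem_nhds hx] with z hz
    exact pushforward_eq_sum_component hΞ hφ X hz
  have hD := hchange _ hV
  simp only [Function.comp_def] at hD
  rw [hJ, hD]
  refine trace_inv_mul_change _ _ _ ?_
  -- Since the metric matrix of φ' is Tᵀ(JᵀJ)T, its positive determinant forces det T ≠ 0.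
  have hpos := metricMatrix_det_pos (g := g) hφ' hx'
  rw [hΞ.isometric φ' hφ' _ hx', hJ, Matrix.transpose_mul, Matrix.mul_assoc, Matrix.det_mul,
    Matrix.det_transpose] at hpos
  exact (left_ne_zero_of_mul hpos.ne').isUnit

/-- The isometry condition is this identity on coordinate vectors; bilinearity extends it to the
whole tangent space. -/
theorem IsIsometricEmbedding.inner_mfderiv (hΞ : IsIsometricEmbedding g Ξ) (A : M)
    (u w : TangentSpace (𝓡 m) A) :
    g.inner A u w = inner ℝ (show EuclideanSpace ℝ (Fin n) from mfderiv (𝓡 m) (𝓡 n) Ξ A u)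
      (show EuclideanSpace ℝ (Fin n) from mfderiv (𝓡 m) (𝓡 n) Ξ A w) := by
  obtain ⟨φ, hφ, x, hx, rfl⟩ : ∃ φ ∈ IsManifold.maximalAtlas (𝓡 m) ∞ M, ∃ x ∈ φ.target,
      φ.symm x = A :=
    ⟨chartAt _ A, IsManifold.chart_mem_maximalAtlas A, _, mem_chart_target _ A,
      (chartAt (EuclideanSpace ℝ (Fin m)) A).left_inv (mem_chart_source _ A)⟩
  have hd : MDifferentiableAt (𝓡 m) (𝓡 n) Ξ (φ.symm x) := hΞ.smooth.mdifferentiableAt (by simp)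
  have hmat : ∀ i j, g.inner (φ.symm x) (coordVec φ x i) (coordVec φ x j) =
      inner ℝ (fderiv ℝ (Ξ ∘ φ.symm) x (EuclideanSpace.single i (1 : ℝ)))
        (fderiv ℝ (Ξ ∘ φ.symm) x (EuclideanSpace.single j (1 : ℝ))) := by
    intro i j
    have := congrFun (congrFun (hΞ.isometric φ hφ x hx) i) j
    rw [Matrix.mul_apply] at this
    refine this.trans ?_
    simp [jacobian, PiLp.inner_apply, mul_comm]
  have expand : ∀ v : TangentSpace (𝓡 m) (φ.symm x), ∃ c : Fin m → ℝ,
      v = ∑ i, c i • coordVec φ x i ∧ (mfderiv (𝓡 m) (𝓡 n) Ξ (φ.symm x) v =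
        ∑ i, c i • fderiv ℝ (Ξ ∘ φ.symm) x (EuclideanSpace.single i (1 : ℝ))) := by
    intro v
    let c : EuclideanSpace ℝ (Fin m) := mfderiv (𝓡 m) (𝓡 m) φ (φ.symm x) v
    have hc : ∑ i, c i • EuclideanSpace.single i (1 : ℝ) = c := sum_smul_single c
    have hv : mfderiv (𝓡 m) (𝓡 m) φ.symm x c = v := mfderiv_symm_mfderiv hφ hx v
    refine ⟨fun i => c i, ?_, ?_⟩
    · rw [← mfderiv_symm_sum_single, hc, hv]
    · rw [← map_eq_sum_single, fderiv_comp_symm hφ hx hd, hv]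
  obtain ⟨c, hu, hu'⟩ := expand u
  obtain ⟨d, hw, hw'⟩ := expand w
  rw [hu', hw']
  change _ = inner ℝ (∑ i, c i • fderiv ℝ (Ξ ∘ φ.symm) x (EuclideanSpace.single i (1 : ℝ)))
    (∑ i, d i • fderiv ℝ (Ξ ∘ φ.symm) x (EuclideanSpace.single i (1 : ℝ)))
  rw [hu, map_sum, _root_.sum_apply, sum_inner]
  refine Finset.sum_congr rfl fun i _ => ?_
  rw [map_smul, _root_.smul_apply, hw, map_sum, inner_sum, Finset.smul_sum]
  refine Finset.sum_congr rfl fun j _ => ?_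
  rw [map_smul, hmat, real_inner_smul_left, real_inner_smul_right]
  rfl

theorem dirDeriv_eq_sum_component (hφ : φ ∈ IsManifold.maximalAtlas (𝓡 m) ∞ M) {A : M}
    (hA : A ∈ φ.source) {f : M → ℝ} (hf : MDifferentiableAt (𝓡 m) 𝓘(ℝ, ℝ) f A)
    (X : (A : M) → TangentSpace (𝓡 m) A) :
    dirDeriv X f A = ∑ i, component φ X i (φ A) *
      fderiv ℝ (f ∘ φ.symm) (φ A) (EuclideanSpace.single i (1 : ℝ)) := by
  have h := mfderiv_apply_eq_sum_component (f := f) hφ (φ.map_source hA)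
    (by rwa [φ.left_inv hA]) X
  rw [φ.left_inv hA] at h
  exact h

end Embedding

/-! ### Tangential projection and ambient derivatives -/

section Ambient

variable {m n : ℕ} {M : Type*} [TopologicalSpace M] [ChartedSpace (EuclideanSpace ℝ (Fin m)) M]
  {Ξ : M → EuclideanSpace ℝ (Fin n)}

/-- A tangent vector is orthogonal to every column of `N`, so Nᵀ annihilates it. With the next
lemma, this identifies I − NNᵀ as the orthogonal projection onto the tangent image. -/
theorem IsNormalBasis.mulVec_of_mem {A : M} {N : Matrix (Fin n) (Fin (n - m)) ℝ}
    (hN : IsNormalBasis Ξ A N) {v : EuclideanSpace ℝ (Fin n)} (hv : v ∈ tangentImage m Ξ A) :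
    (1 - N * Nᵀ) *ᵥ v.ofLp = v.ofLp := by
  have h0 : Nᵀ *ᵥ v.ofLp = 0 := by
    ext k
    have hk : (WithLp.toLp 2 (N.col k) : EuclideanSpace ℝ (Fin n)) ∈ (tangentImage m Ξ A)ᗮ := by
      rw [← hN.2]
      exact Submodule.subset_span ⟨k, rfl⟩
    have := (Submodule.mem_orthogonal _ _).1 hk v hv
    simpa [PiLp.inner_apply, Matrix.mulVec, dotProduct, Matrix.col] using this
  rw [Matrix.sub_mulVec, Matrix.one_mulVec, ← Matrix.mulVec_mulVec, h0, Matrix.mulVec_zero,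
    sub_zero]

/-- Orthonormality is NᵀN = I, so (I − NNᵀ)N = 0, and the columns of `N` span the normal space. -/
theorem IsNormalBasis.mulVec_of_mem_orthogonal {A : M} {N : Matrix (Fin n) (Fin (n - m)) ℝ}
    (hN : IsNormalBasis Ξ A N) {v : EuclideanSpace ℝ (Fin n)} (hv : v ∈ (tangentImage m Ξ A)ᗮ) :
    (1 - N * Nᵀ) *ᵥ v.ofLp = 0 := by
  have hNN : Nᵀ * N = 1 := by
    ext k l
    have := orthonormal_iff_ite.1 hN.1 k l
    rw [Matrix.one_apply, ← this, Matrix.mul_apply]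
    simp [PiLp.inner_apply, Matrix.col, mul_comm]
  rw [← hN.2] at hv
  induction hv using Submodule.span_induction with
  | mem v hv =>
    obtain ⟨k, rfl⟩ := hv
    change (1 - N * Nᵀ) *ᵥ N.col k = 0
    have : N.col k = N *ᵥ Pi.single k 1 := (Matrix.mulVec_single_one N k).symm
    rw [this, Matrix.mulVec_mulVec, Matrix.sub_mul, Matrix.one_mul, Matrix.mul_assoc, hNN,
      Matrix.mul_one, sub_self, Matrix.zero_mulVec]
  | zero => simp
  | add u w _ _ hu hw => rw [WithLp.ofLp_add, Matrix.mulVec_add, hu, hw, add_zero]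
  | smul c u _ hu => rw [WithLp.ofLp_smul, Matrix.mulVec_smul, hu, smul_zero]

variable [IsManifold (𝓡 m) ∞ M] {φ : OpenPartialHomeomorph M (EuclideanSpace ℝ (Fin m))}
  {g : RiemannMetric m M}

/-- The tangential part of the ambient gradient is the push-forward of the Riemannian gradient. -/
theorem IsIsometricEmbedding.pushforward_grad (hΞ : IsIsometricEmbedding g Ξ) {A : M}
    {N : Matrix (Fin n) (Fin (n - m)) ℝ} (hN : IsNormalBasis Ξ A N) {f : M → ℝ}
    {h : EuclideanSpace ℝ (Fin n) → ℝ} (hf : IsAmbientExpr Ξ A f h) :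
    pushforward Ξ (grad g f) A = WithLp.toLp 2 ((1 - N * Nᵀ) *ᵥ ambGrad h (Ξ A)) := by
  set V : EuclideanSpace ℝ (Fin n) := pushforward Ξ (grad g f) A with hV
  have hd : MDifferentiableAt (𝓡 m) (𝓡 n) Ξ A := hΞ.smooth.mdifferentiableAt (by simp)
  have hVT : V ∈ tangentImage m Ξ A := ⟨grad g f A, rfl⟩
  -- Paired with a tangent vector Ξ_*w, both ∇h and Ξ_* grad f give df(w), by the chain rule and by
  -- isometry respectively. The difference is therefore normal.
  have hperp : (WithLp.toLp 2 (ambGrad h (Ξ A)) - V : EuclideanSpace ℝ (Fin n)) ∈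
      (tangentImage m Ξ A)ᗮ := by
    rw [Submodule.mem_orthogonal]
    rintro _ ⟨w, rfl⟩
    let dw : EuclideanSpace ℝ (Fin n) := mfderiv (𝓡 m) (𝓡 n) Ξ A w
    change inner ℝ dw _ = 0
    have h1 : inner ℝ V dw = mfderiv (𝓡 m) 𝓘(ℝ, ℝ) f A w := by
      rw [← inner_grad g f A w, hΞ.inner_mfderiv A]
      rfl
    have h2 : mfderiv (𝓡 m) 𝓘(ℝ, ℝ) f A w = fderiv ℝ h (Ξ A) dw := by
      have hh : MDifferentiableAt (𝓡 n) 𝓘(ℝ, ℝ) h (Ξ A) :=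
        (hf.1.differentiableAt (by simp)).mdifferentiableAt
      have : mfderiv (𝓡 m) 𝓘(ℝ, ℝ) (h ∘ Ξ) A = mfderiv (𝓡 m) 𝓘(ℝ, ℝ) f A :=
        Filter.EventuallyEq.mfderiv_eq hf.2
      rw [← this, mfderiv_comp A hh hd, mfderiv_eq_fderiv]
      rfl
    have h3 : fderiv ℝ h (Ξ A) dw = inner ℝ dw (WithLp.toLp 2 (ambGrad h (Ξ A))) := by
      rw [fderiv_eq_sum_ambGrad]
      simp [PiLp.inner_apply, mul_comm]
    rw [inner_sub_right, ← h3, ← h2, ← h1, real_inner_comm, sub_self]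
  have e1 := hN.mulVec_of_mem hVT
  have e2 := hN.mulVec_of_mem_orthogonal hperp
  rw [WithLp.ofLp_sub, Matrix.mulVec_sub, e1, sub_eq_zero] at e2
  rw [e2]

theorem IsIsometricEmbedding.mem_tangentImage_iff (hΞ : IsIsometricEmbedding g Ξ)
    (hφ : φ ∈ IsManifold.maximalAtlas (𝓡 m) ∞ M) {x : EuclideanSpace ℝ (Fin m)}
    (hx : x ∈ φ.target) {v : EuclideanSpace ℝ (Fin n)} :
    v ∈ tangentImage m Ξ (φ.symm x) ↔ ∃ c : Fin m → ℝ, v.ofLp = jacobian Ξ φ x *ᵥ c := by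
  have hd : MDifferentiableAt (𝓡 m) (𝓡 n) Ξ (φ.symm x) := hΞ.smooth.mdifferentiableAt (by simp)
  have hJ : ∀ c : EuclideanSpace ℝ (Fin m),
      jacobian Ξ φ x *ᵥ c.ofLp = (fderiv ℝ (Ξ ∘ φ.symm) x c).ofLp := by
    intro c
    rw [map_eq_sum_single]
    ext α
    simp [Matrix.mulVec, dotProduct, jacobian, mul_comm]
  constructor
  · rintro ⟨w, rfl⟩
    let c : EuclideanSpace ℝ (Fin m) := mfderiv (𝓡 m) (𝓡 m) φ (φ.symm x) w
    refine ⟨c.ofLp, ?_⟩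
    rw [hJ, fderiv_comp_symm hφ hx hd,
      show mfderiv (𝓡 m) (𝓡 m) φ.symm x c = w from mfderiv_symm_mfderiv hφ hx w]
    rfl
  · rintro ⟨c, hc⟩
    refine ⟨mfderiv (𝓡 m) (𝓡 m) φ.symm x (WithLp.toLp 2 c), ?_⟩
    have h1 := hJ (WithLp.toLp 2 c)
    rw [← hc, fderiv_comp_symm hφ hx hd] at h1
    exact (WithLp.ofLp_injective 2 h1).symm

/-- The two expressions of the orthogonal projection on the tangent space. -/
theorem IsIsometricEmbedding.jacobian_mul_inv_mul (hΞ : IsIsometricEmbedding g Ξ)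
    (hφ : φ ∈ IsManifold.maximalAtlas (𝓡 m) ∞ M) {x : EuclideanSpace ℝ (Fin m)}
    (hx : x ∈ φ.target) {N : Matrix (Fin n) (Fin (n - m)) ℝ}
    (hN : IsNormalBasis Ξ (φ.symm x) N) :
    jacobian Ξ φ x * ((metricMatrix g φ x)⁻¹ * (jacobian Ξ φ x)ᵀ) = 1 - N * Nᵀ := by
  have hG := hΞ.isometric φ hφ x hx
  have hu : IsUnit (metricMatrix g φ x).det := (metricMatrix_det_pos hφ hx).ne'.isUnit
  set J := jacobian Ξ φ x
  set G := metricMatrix g φ x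
  -- It suffices to compare both sides on vectors v: JG⁻¹Jᵀv is tangent, and the remainder is killed
  -- by Jᵀ because JᵀJ = G, hence is normal.
  refine Matrix.ext_of_mulVec_single fun β => ?_
  generalize (Pi.single β 1 : Fin n → ℝ) = v
  let c : Fin m → ℝ := (G⁻¹ * Jᵀ) *ᵥ v
  have h1 : (1 - N * Nᵀ) *ᵥ (J *ᵥ c) = J *ᵥ c :=
    hN.mulVec_of_mem (v := WithLp.toLp 2 (J *ᵥ c))
      ((hΞ.mem_tangentImage_iff hφ hx).2 ⟨c, rfl⟩)
  have h2 : (1 - N * Nᵀ) *ᵥ (v - J *ᵥ c) = 0 := by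
    refine hN.mulVec_of_mem_orthogonal (v := WithLp.toLp 2 (v - J *ᵥ c)) ?_
    rw [Submodule.mem_orthogonal]
    intro u hu'
    obtain ⟨d, hd⟩ := (hΞ.mem_tangentImage_iff hφ hx).1 hu'
    have hJ0 : Jᵀ *ᵥ (v - J *ᵥ c) = 0 := by
      simp only [c, Matrix.mulVec_sub, Matrix.mulVec_mulVec]
      rw [← Matrix.mul_assoc, ← hG, ← Matrix.mul_assoc, Matrix.mul_nonsing_inv _ hu,
        Matrix.one_mul, sub_self]
    have : inner ℝ u (WithLp.toLp 2 (v - J *ᵥ c)) = (v - J *ᵥ c) ⬝ᵥ u.ofLp := by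
      simp [PiLp.inner_apply, dotProduct]
    rw [this, hd, Matrix.dotProduct_mulVec, ← Matrix.mulVec_transpose, hJ0, zero_dotProduct]
  rw [Matrix.mulVec_sub, h1, sub_eq_zero] at h2
  rw [h2, Matrix.mulVec_mulVec]

theorem IsIsometricEmbedding.fderiv_comp_embedding (hΞ : IsIsometricEmbedding g Ξ)
    (hφ : φ ∈ IsManifold.maximalAtlas (𝓡 m) ∞ M) {x : EuclideanSpace ℝ (Fin m)}
    (hx : x ∈ φ.target) {h : EuclideanSpace ℝ (Fin n) → ℝ}
    (hh : DifferentiableAt ℝ h (Ξ (φ.symm x))) (i : Fin m) :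
    fderiv ℝ (fun z => h (Ξ (φ.symm z))) x (EuclideanSpace.single i (1 : ℝ)) =
      ∑ α, jacobian Ξ φ x α i * ambGrad h (Ξ (φ.symm x)) α := by
  have hY : DifferentiableAt ℝ (Ξ ∘ φ.symm) x :=
    ((contDiffOn_comp_symm hφ hΞ.smooth).contDiffAt
      (φ.open_target.mem_nhds hx)).differentiableAt (by simp)
  have := fderiv_comp (g := h) x hh hY
  change fderiv ℝ (h ∘ (Ξ ∘ φ.symm)) x _ = _
  rw [this, ContinuousLinearMap.comp_apply, fderiv_eq_sum_ambGrad]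
  rfl

/-- The chain rule is needed on a whole neighbourhood of x, because the components of the gradient
are differentiated once more in the divergence. -/
theorem IsIsometricEmbedding.eventually_fderiv_comp_symm (hΞ : IsIsometricEmbedding g Ξ)
    (hφ : φ ∈ IsManifold.maximalAtlas (𝓡 m) ∞ M) {x : EuclideanSpace ℝ (Fin m)}
    (hx : x ∈ φ.target) {f : M → ℝ} {h : EuclideanSpace ℝ (Fin n) → ℝ}
    (hf : IsAmbientExpr Ξ (φ.symm x) f h) :
    ∀ᶠ z in 𝓝 x, ∀ i, fderiv ℝ (f ∘ φ.symm) z (EuclideanSpace.single i (1 : ℝ)) =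
      ∑ α, jacobian Ξ φ z α i * ambGrad h (Ξ (φ.symm z)) α := by
  have hc : ContinuousAt φ.symm x := φ.continuousAt_symm hx
  have hcY : ContinuousAt (Ξ ∘ φ.symm) x := hΞ.smooth.continuous.continuousAt.comp hc
  filter_upwards [φ.open_target.mem_nhds hx, (hc.eventually hf.2).eventually_nhds,
    hcY.eventually ((hf.1.of_le (m := 1) (mod_cast le_top)).eventually (by simp))]
    with z hz h1 h2 i
  rw [← hΞ.fderiv_comp_embedding hφ hz (h2.differentiableAt (by simp)) i]
  refine congrArg (fun T : EuclideanSpace ℝ (Fin m) →L[ℝ] ℝ => T _)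
    (Filter.EventuallyEq.fderiv_eq ?_)
  filter_upwards [h1] with w hw
  exact hw.symm

end Ambient

/-! ### The integrand in an arbitrary chart and in the ambient space -/

section Stein

variable {m n : ℕ} {M : Type*} [TopologicalSpace M] [ChartedSpace (EuclideanSpace ℝ (Fin m)) M]
  [IsManifold (𝓡 m) ∞ M] {φ : OpenPartialHomeomorph M (EuclideanSpace ℝ (Fin m))}
  {g : RiemannMetric m M} {Ξ : M → EuclideanSpace ℝ (Fin n)}

/-- This is where the preferred chart in `div` is exchanged for an arbitrary one; smoothness of the
components of grad f in every chart allows it. -/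
theorem IsIsometricEmbedding.stein_grad_eq_chart (hΞ : IsIsometricEmbedding g Ξ)
    (hφ : φ ∈ IsManifold.maximalAtlas (𝓡 m) ∞ M) {p : M → ℝ} (hp : ContMDiff (𝓡 m) 𝓘(ℝ, ℝ) ∞ p)
    (hp_pos : ∀ A, 0 < p A) {f : M → ℝ} (hf : ContMDiff (𝓡 m) 𝓘(ℝ, ℝ) ∞ f) {A : M}
    (hA : A ∈ φ.source) :
    stein g p (grad g f) A = (∑ i, component φ (grad g f) i (φ A) *
        fderiv ℝ ((fun B => Real.log (p B)) ∘ φ.symm) (φ A) (EuclideanSpace.single i (1 : ℝ))) +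
      chartDiv g φ (grad g f) (φ A) := by
  have hlog : MDifferentiableAt (𝓡 m) 𝓘(ℝ, ℝ) (fun B => Real.log (p B)) A := by
    have h1 : MDifferentiableAt 𝓘(ℝ, ℝ) 𝓘(ℝ, ℝ) Real.log (p A) :=
      (Real.differentiableAt_log (hp_pos A).ne').mdifferentiableAt
    exact h1.comp A (hp.mdifferentiableAt (by simp))
  have hcomp : ∀ φ ∈ IsManifold.maximalAtlas (𝓡 m) ∞ M, A ∈ φ.source → ∀ i,
      DifferentiableAt ℝ (component φ (grad g f) i) (φ A) := fun φ hφ hA i =>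
    ((hΞ.contDiffOn_component_grad hφ hf i).contDiffAt
      (φ.open_target.mem_nhds (φ.map_source hA))).differentiableAt (by simp)
  have hchart := IsManifold.chart_mem_maximalAtlas (I := 𝓡 m) (n := ∞) A
  rw [stein, dirDeriv_eq_sum_component hφ hA hlog, div,
    hΞ.chartDiv_eq_chartDiv hφ hchart hA (mem_chart_source _ A) (hcomp φ hφ hA)
      (hcomp _ hchart (mem_chart_source _ A))]

/-- The Stein operator applied to a gradient, in the embedded space. -/
theorem IsIsometricEmbedding.stein_grad_eq_embIntegrand (hΞ : IsIsometricEmbedding g Ξ)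
    (hφ : φ ∈ IsManifold.maximalAtlas (𝓡 m) ∞ M) {p : M → ℝ} (hp : ContMDiff (𝓡 m) 𝓘(ℝ, ℝ) ∞ p)
    (hp_pos : ∀ A, 0 < p A) {f : M → ℝ} (hf : ContMDiff (𝓡 m) 𝓘(ℝ, ℝ) ∞ f)
    {x : EuclideanSpace ℝ (Fin m)} (hx : x ∈ φ.target)
    {N : Matrix (Fin n) (Fin (n - m)) ℝ} {L k : EuclideanSpace ℝ (Fin n) → ℝ}
    {W : EuclideanSpace ℝ (Fin n) → Matrix (Fin m) (Fin n) ℝ}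
    (hN : IsNormalBasis Ξ (φ.symm x) N)
    (hL : IsAmbientExpr Ξ (φ.symm x)
      (fun B => Real.log (p B * √(metricMatrix g φ (φ B)).det)) L)
    (hk : IsAmbientExpr Ξ (φ.symm x) f k)
    (hW : ∀ i β, IsAmbientExpr Ξ (φ.symm x)
      (fun B => ((metricMatrix g φ (φ B))⁻¹ * (jacobian Ξ φ (φ B))ᵀ) i β) (fun y => W y i β)) :
    stein g p (grad g f) (φ.symm x) =
      embIntegrand (jacobian Ξ φ x) N L k W (Ξ (φ.symm x)) := by
  let e : Fin m → EuclideanSpace ℝ (Fin m) := fun i => EuclideanSpace.single i (1 : ℝ)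
  set y : EuclideanSpace ℝ (Fin n) := Ξ (φ.symm x) with hy
  set J := jacobian Ξ φ x with hJ
  set c : Fin m → EuclideanSpace ℝ (Fin m) → ℝ := fun i => component φ (grad g f) i with hc
  have hcd : ∀ i, DifferentiableAt ℝ (c i) x := fun i =>
    ((hΞ.contDiffOn_component_grad hφ hf i).contDiffAt
      (φ.open_target.mem_nhds hx)).differentiableAt (by simp)
  have hGd : 0 < (metricMatrix g φ x).det := metricMatrix_det_pos hφ hx
  have hsd : DifferentiableAt ℝ (fun z => √(metricMatrix g φ z).det) x :=
    (((contDiffOn_det (hΞ.contDiffOn_metricMatrix hφ)).contDiffAt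
      (φ.open_target.mem_nhds hx)).differentiableAt (by simp)).sqrt hGd.ne'
  have hs0 : √(metricMatrix g φ x).det ≠ 0 := (Real.sqrt_pos.2 hGd).ne'
  have hpd : DifferentiableAt ℝ (p ∘ φ.symm) x :=
    ((contDiffOn_comp_symm hφ hp).contDiffAt (φ.open_target.mem_nhds hx)).differentiableAt (by simp)
  have hp0 : p (φ.symm x) ≠ 0 := (hp_pos _).ne'
  -- the components near the point, in ambient terms
  have hcW : ∀ i, ∀ᶠ z in 𝓝 x, c i z =
      ∑ β, W (Ξ (φ.symm z)) i β * ambGrad k (Ξ (φ.symm z)) β := by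
    intro i
    have hcs : ContinuousAt φ.symm x := φ.continuousAt_symm hx
    have hWe : ∀ᶠ z in 𝓝 x, ∀ β, W (Ξ (φ.symm z)) i β =
        ((metricMatrix g φ (φ (φ.symm z)))⁻¹ * (jacobian Ξ φ (φ (φ.symm z)))ᵀ) i β :=
      Filter.eventually_all.2 fun β => hcs.eventually (hW i β).2
    filter_upwards [φ.open_target.mem_nhds hx, hWe, hΞ.eventually_fderiv_comp_symm hφ hx hk]
      with z hz h1 h2
    simp only [hc, component_grad hφ hz (hf.mdifferentiableAt (by simp)) i, h1, h2,
      φ.right_inv hz, Matrix.mul_apply, Matrix.transpose_apply, Finset.mul_sum, Finset.sum_mul]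
    rw [Finset.sum_comm]
    refine Finset.sum_congr rfl fun β _ => Finset.sum_congr rfl fun j _ => ?_
    ring
  have hgk : ∀ β, DifferentiableAt ℝ (fun w => ambGrad k w β) y := fun β =>
    ((hk.1.fderiv_right (m := 1) (mod_cast le_top : ((2 : ℕ∞) : WithTop ℕ∞) ≤ ∞)).differentiableAt
      one_ne_zero).clm_apply (differentiableAt_const _)
  have hWd : ∀ i β, DifferentiableAt ℝ (fun w => W w i β) y := fun i β =>
    (hW i β).1.differentiableAt (by simp)
  have hYd : DifferentiableAt ℝ (Ξ ∘ φ.symm) x :=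
    ((contDiffOn_comp_symm hφ hΞ.smooth).contDiffAt
      (φ.open_target.mem_nhds hx)).differentiableAt (by simp)
  -- Coordinate differentiation along the embedding is the tangential operator (Jᵀ∇)ᵢ. Applied to
  -- W∇k, it produces a Hessian term and a term in the derivative of `W`.
  have hdc : ∀ i, fderiv ℝ (c i) x (e i) =
      ∑ β, (W y i β * (∑ α, J α i * ambHess k y α β) +
        ambGrad k y β * ∑ α, J α i * ambGrad (fun w => W w i β) y α) := by
    intro i
    have h1 : ∀ β, HasFDerivAt (fun z => W (Ξ (φ.symm z)) i β * ambGrad k (Ξ (φ.symm z)) β)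
        (W y i β • fderiv ℝ (fun z => ambGrad k (Ξ (φ.symm z)) β) x +
          ambGrad k y β • fderiv ℝ (fun z => W (Ξ (φ.symm z)) i β) x) x := fun β =>
      HasFDerivAt.fun_mul (DifferentiableAt.comp x (g := fun w => W w i β)
          (hWd i β) hYd).hasFDerivAt
        (DifferentiableAt.comp x (g := fun w => ambGrad k w β) (hgk β) hYd).hasFDerivAt
    rw [Filter.EventuallyEq.fderiv_eq (hcW i), (HasFDerivAt.fun_sum fun β _ => h1 β).fderiv]
    simp only [_root_.sum_apply, _root_.add_apply, _root_.smul_apply, smul_eq_mul, e]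
    refine Finset.sum_congr rfl fun β _ => ?_
    rw [hΞ.fderiv_comp_embedding hφ hx (h := fun w => ambGrad k w β) (hgk β) i,
      hΞ.fderiv_comp_embedding hφ hx (h := fun w => W w i β) (hWd i β) i]
    rfl
  -- the logarithmic density of the chart
  have hLe : ∀ i, fderiv ℝ ((fun B => Real.log (p B)) ∘ φ.symm) x (e i) +
      fderiv ℝ (fun z => √(metricMatrix g φ z).det) x (e i) / √(metricMatrix g φ x).det =
      ∑ α, J α i * ambGrad L y α := by
    intro i
    rw [← (hΞ.eventually_fderiv_comp_symm hφ hx hL).self_of_nhds i]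
    have h1 : ((fun B => Real.log (p B * √(metricMatrix g φ (φ B)).det)) ∘ φ.symm) =ᶠ[𝓝 x]
        fun z => Real.log ((p ∘ φ.symm) z) + Real.log (√(metricMatrix g φ z).det) := by
      filter_upwards [φ.open_target.mem_nhds hx] with z hz
      simp only [Function.comp_apply, φ.right_inv hz]
      exact Real.log_mul (hp_pos _).ne' (Real.sqrt_pos.2 (metricMatrix_det_pos hφ hz)).ne'
    have h2 := hpd.hasFDerivAt.log (by exact hp0)
    rw [h1.fderiv_eq, (h2.fun_add (hsd.hasFDerivAt.log hs0)).fderiv, _root_.add_apply]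
    have h3 : fderiv ℝ ((fun B => Real.log (p B)) ∘ φ.symm) x = _ := h2.fderiv
    rw [h3]
    simp only [_root_.smul_apply, smul_eq_mul, e]
    rw [div_eq_inv_mul]
  have hdiv : chartDiv g φ (grad g f) x = ∑ i, (fderiv ℝ (c i) x (e i) +
      c i x * (fderiv ℝ (fun z => √(metricMatrix g φ z).det) x (e i) /
        √(metricMatrix g φ x).det)) := by
    rw [chartDiv, Finset.sum_div]
    refine Finset.sum_congr rfl fun i _ => ?_
    have := (hsd.hasFDerivAt.fun_mul (hcd i).hasFDerivAt).fderiv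
    simp only [hc] at this ⊢
    rw [this]
    simp only [_root_.add_apply, _root_.smul_apply, smul_eq_mul, e]
    field_simp
  have hA : φ.symm x ∈ φ.source := φ.map_target hx
  have hst := hΞ.stein_grad_eq_chart hφ hp hp_pos hf hA
  rw [φ.right_inv hx] at hst
  rw [hst, hdiv, Finset.sum_add_distrib]
  have hsum : ∑ i, c i x * fderiv ℝ ((fun B => Real.log (p B)) ∘ φ.symm) x (e i) +
      ∑ i, c i x * (fderiv ℝ (fun z => √(metricMatrix g φ z).det) x (e i) /
        √(metricMatrix g φ x).det) = ∑ i, c i x * (Jᵀ *ᵥ ambGrad L y) i := by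
    rw [← Finset.sum_add_distrib]
    refine Finset.sum_congr rfl fun i _ => ?_
    rw [← mul_add, hLe]
    rfl
  have hcx : ∀ i, c i x = (W y *ᵥ ambGrad k y) i := fun i => (hcW i).self_of_nhds
  -- On the embedded manifold `W` equals G⁻¹Jᵀ, so `J * W` is the tangential projection; this turns
  -- coordinate contractions into expressions in `N`.
  have hP : J * W y = 1 - N * Nᵀ := by
    rw [← hΞ.jacobian_mul_inv_mul hφ hx hN]
    congr 1
    ext i β
    have := (hW i β).2.self_of_nhds
    simpa only [φ.right_inv hx] using this
  have hfirst : ∑ i, c i x * (Jᵀ *ᵥ ambGrad L y) i =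
      ambGrad L y ⬝ᵥ ((1 - N * Nᵀ) *ᵥ ambGrad k y) := by
    rw [← hP, ← Matrix.mulVec_mulVec, Matrix.dotProduct_mulVec, ← Matrix.mulVec_transpose]
    simp only [hcx, dotProduct, mul_comm]
  have hsecond : ∑ i, fderiv ℝ (c i) x (e i) = (ambHess k y).trace -
      (Nᵀ * ambHess k y * N).trace + rowDiv J W y ⬝ᵥ ambGrad k y := by
    have ht : (ambHess k y).trace - (Nᵀ * ambHess k y * N).trace =
        ∑ i, ∑ β, W y i β * ∑ α, J α i * ambHess k y α β := by
      have hPs : (1 - N * Nᵀ)ᵀ = 1 - N * Nᵀ := by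
        simp [Matrix.transpose_sub, Matrix.transpose_mul]
      calc (ambHess k y).trace - (Nᵀ * ambHess k y * N).trace
          = ((1 - N * Nᵀ) * ambHess k y).trace := by
            rw [Matrix.sub_mul, Matrix.one_mul, Matrix.trace_sub, Matrix.trace_mul_cycle]
        _ = ((J * W y)ᵀ * ambHess k y).trace := by rw [hP, hPs]
        _ = _ := by
            simp only [Matrix.trace, Matrix.diag_apply, Matrix.mul_apply, Matrix.transpose_apply,
              Finset.sum_mul, Finset.mul_sum]
            conv_lhs => enter [2, β]; rw [Finset.sum_comm]
            rw [Finset.sum_comm]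
            refine Finset.sum_congr rfl fun i _ => Finset.sum_congr rfl fun β _ =>
              Finset.sum_congr rfl fun α _ => ?_
            ring
    rw [ht]
    simp only [hdc, Finset.sum_add_distrib]
    congr 1
    simp only [rowDiv, dotProduct, Finset.sum_mul, Finset.mul_sum]
    rw [Finset.sum_comm]
    refine Finset.sum_congr rfl fun i _ => Finset.sum_congr rfl fun β _ =>
      Finset.sum_congr rfl fun α _ => ?_
    ring
  have hgoal : embIntegrand J N L k W y = ∑ i, c i x * (Jᵀ *ᵥ ambGrad L y) i +
      ∑ i, fderiv ℝ (c i) x (e i) := by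
    rw [hfirst, hsecond, embIntegrand]
    ring
  rw [hgoal, ← hsum]
  simp only [hc, e]
  ring

end Stein

/-! ### The feature map of a reproducing kernel Hilbert space -/

section Kernel

variable {X : Type*} {H : Type*} [NormedAddCommGroup H] [InnerProductSpace ℝ H] [CompleteSpace H]
  [RKHS ℝ H X ℝ]

variable (H) in
/-- The canonical feature map of a reproducing kernel Hilbert space of real functions. -/
noncomputable def featureMap (A : X) : H := RKHS.kerFun H A 1

theorem inner_featureMap (A : X) (f : H) : inner ℝ (featureMap H A) f = f A := by
  rw [featureMap, RKHS.kerFun_inner]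
  simp

theorem featureMap_apply {K : X → X → ℝ} (hHK : ∀ A B, RKHS.kernel H A B 1 = K A B) (A B : X) :
    featureMap H B A = K A B := by
  rw [featureMap, RKHS.kerFun_apply, hHK]

theorem comp_eq_inner_featureMap {Y : Type*} (f : H) (a : Y → X) :
    (f : X → ℝ) ∘ a = fun z => inner ℝ ((featureMap H ∘ a) z) f := by
  ext z
  rw [Function.comp_apply, Function.comp_apply, inner_featureMap]

end Kernel

/-! ### Smoothness of H and pointwise representation of the integrand -/

section SmoothKernel

variable {m : ℕ} {M : Type*} [TopologicalSpace M] [ChartedSpace (EuclideanSpace ℝ (Fin m)) M]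
  {φ : OpenPartialHomeomorph M (EuclideanSpace ℝ (Fin m))}
  {K : M → M → ℝ} {H : Type*} [NormedAddCommGroup H] [InnerProductSpace ℝ H] [CompleteSpace H]
  [RKHS ℝ H M ℝ]

/-- The feature map of a smooth kernel is smooth in every chart. -/
theorem contDiffOn_featureMap_comp_symm (hφ : φ ∈ IsManifold.maximalAtlas (𝓡 m) ∞ M)
    (hK : ContMDiff ((𝓡 m).prod (𝓡 m)) 𝓘(ℝ, ℝ) ∞ (fun z : M × M => K z.1 z.2))
    (hHK : ∀ A B, RKHS.kernel H A B 1 = K A B) :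
    ContDiffOn ℝ ∞ (featureMap H ∘ φ.symm) φ.target := by
  have hsym := contMDiffOn_symm_of_mem_maximalAtlas hφ
  have h1 : ContMDiffOn 𝓘(ℝ, EuclideanSpace ℝ (Fin m) × EuclideanSpace ℝ (Fin m)) (𝓡 m) ∞
      (fun z : EuclideanSpace ℝ (Fin m) × EuclideanSpace ℝ (Fin m) => φ.symm z.1)
      (φ.target ×ˢ φ.target) :=
    hsym.comp contDiff_fst.contMDiff.contMDiffOn fun z hz => hz.1
  have h2 : ContMDiffOn 𝓘(ℝ, EuclideanSpace ℝ (Fin m) × EuclideanSpace ℝ (Fin m)) (𝓡 m) ∞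
      (fun z : EuclideanSpace ℝ (Fin m) × EuclideanSpace ℝ (Fin m) => φ.symm z.2)
      (φ.target ×ˢ φ.target) :=
    hsym.comp contDiff_snd.contMDiff.contMDiffOn fun z hz => hz.2
  have h3 : ContDiffOn ℝ ∞ (fun z : EuclideanSpace ℝ (Fin m) × EuclideanSpace ℝ (Fin m) =>
      K (φ.symm z.1) (φ.symm z.2)) (φ.target ×ˢ φ.target) :=
    (hK.comp_contMDiffOn (h1.prodMk h2)).contDiffOn
  refine contDiffOn_infty.2 fun r => contDiffOn_of_contDiffOn_inner φ.open_target r ?_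
  refine h3.congr fun z _ => ?_
  rw [Function.comp_apply, Function.comp_apply, inner_featureMap, featureMap_apply hHK]

variable [IsManifold (𝓡 m) ∞ M]

/-- The elements of the reproducing kernel Hilbert space of a smooth kernel are smooth. -/
theorem contMDiff_of_contMDiff_kernel
    (hK : ContMDiff ((𝓡 m).prod (𝓡 m)) 𝓘(ℝ, ℝ) ∞ (fun z : M × M => K z.1 z.2))
    (hHK : ∀ A B, RKHS.kernel H A B 1 = K A B) (f : H) :
    ContMDiff (𝓡 m) 𝓘(ℝ, ℝ) ∞ (f : M → ℝ) := by
  intro A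
  let φ := chartAt (EuclideanSpace ℝ (Fin m)) A
  have hφ : φ ∈ IsManifold.maximalAtlas (𝓡 m) ∞ M := IsManifold.chart_mem_maximalAtlas A
  have h1 : ContDiffOn ℝ ∞ ((f : M → ℝ) ∘ φ.symm) φ.target := by
    rw [comp_eq_inner_featureMap]
    exact (contDiffOn_featureMap_comp_symm hφ hK hHK).inner ℝ contDiffOn_const
  have h2 : ContMDiffOn (𝓡 m) 𝓘(ℝ, ℝ) ∞ (((f : M → ℝ) ∘ φ.symm) ∘ φ) φ.source :=
    h1.contMDiffOn.comp (contMDiffOn_of_mem_maximalAtlas hφ) φ.mapsTo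
  have hA : φ.source ∈ 𝓝 A := φ.open_source.mem_nhds (mem_chart_source _ A)
  refine (h2.contMDiffAt hA).congr_of_eventuallyEq ?_
  filter_upwards [hA] with B hB
  simp [φ.left_inv hB]

/-- The Stein operator is represented at each point by an element of the Hilbert space. -/
theorem IsIsometricEmbedding.exists_stein_grad_eq_inner {n : ℕ} {g : RiemannMetric m M}
    {Ξ : M → EuclideanSpace ℝ (Fin n)} (hΞ : IsIsometricEmbedding g Ξ) {p : M → ℝ}
    (hp : ContMDiff (𝓡 m) 𝓘(ℝ, ℝ) ∞ p) (hp_pos : ∀ A, 0 < p A)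
    (hK : ContMDiff ((𝓡 m).prod (𝓡 m)) 𝓘(ℝ, ℝ) ∞ (fun z : M × M => K z.1 z.2))
    (hHK : ∀ A B, RKHS.kernel H A B 1 = K A B) (A : M) :
    ∃ s : H, ∀ f : H, stein g p (grad g f) A = inner ℝ s f := by
  let φ := chartAt (EuclideanSpace ℝ (Fin m)) A
  let e : Fin m → EuclideanSpace ℝ (Fin m) := fun i => EuclideanSpace.single i (1 : ℝ)
  have hφ : φ ∈ IsManifold.maximalAtlas (𝓡 m) ∞ M := IsManifold.chart_mem_maximalAtlas A
  have hx : φ A ∈ φ.target := mem_chart_target _ A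
  have hψ := contDiffOn_featureMap_comp_symm hφ hK hHK
  set ψ : EuclideanSpace ℝ (Fin m) → H := featureMap H ∘ φ.symm with hψdef
  -- `Θ i` represents the i-th component of grad f: pairing with f commutes with derivatives of ψ.
  -- Differentiating ρΘᵢ then represents the divergence as well.
  let Θ : Fin m → EuclideanSpace ℝ (Fin m) → H := fun i z =>
    ∑ j, (metricMatrix g φ z)⁻¹ i j • fderiv ℝ ψ z (e j)
  let ρ : EuclideanSpace ℝ (Fin m) → ℝ := fun z => √(metricMatrix g φ z).det
  have hΘ : ∀ i, ∀ z ∈ φ.target, ∀ f : H, component φ (grad g f) i z = inner ℝ (Θ i z) f := by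
    intro i z hz f
    have hd : DifferentiableAt ℝ ψ z :=
      (hψ.contDiffAt (φ.open_target.mem_nhds hz)).differentiableAt (by simp)
    rw [component_grad hφ hz
      ((contMDiff_of_contMDiff_kernel hK hHK f).mdifferentiableAt (by simp)) i, sum_inner]
    refine Finset.sum_congr rfl fun j _ => ?_
    rw [real_inner_smul_left, comp_eq_inner_featureMap,
      (hd.hasFDerivAt.inner ℝ (hasFDerivAt_const f z)).fderiv]
    simp [e]
  have hΘd : ∀ i, DifferentiableAt ℝ (Θ i) (φ A) := by
    intro i
    refine DifferentiableAt.fun_sum fun j _ => DifferentiableAt.fun_smul ?_ ?_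
    · exact ((contDiffOn_inv_apply (hΞ.contDiffOn_metricMatrix hφ)
        (fun z hz => (metricMatrix_det_pos hφ hz).ne') i j).contDiffAt
        (φ.open_target.mem_nhds hx)).differentiableAt (by simp)
    · exact (((hψ.contDiffAt (φ.open_target.mem_nhds hx)).fderiv_right (m := 1)
        (mod_cast le_top : ((2 : ℕ∞) : WithTop ℕ∞) ≤ ∞)).differentiableAt one_ne_zero).clm_apply
        (differentiableAt_const _)
  have hρd : DifferentiableAt ℝ ρ (φ A) :=
    (((contDiffOn_det (hΞ.contDiffOn_metricMatrix hφ)).contDiffAt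
      (φ.open_target.mem_nhds hx)).differentiableAt (by simp)).sqrt
      (metricMatrix_det_pos hφ hx).ne'
  refine ⟨(∑ i, fderiv ℝ ((fun B => Real.log (p B)) ∘ φ.symm) (φ A) (e i) • Θ i (φ A)) +
    (ρ (φ A))⁻¹ • ∑ i, fderiv ℝ (fun z => ρ z • Θ i z) (φ A) (e i), fun f => ?_⟩
  rw [hΞ.stein_grad_eq_chart hφ hp hp_pos (contMDiff_of_contMDiff_kernel hK hHK f)
    (mem_chart_source _ A), inner_add_left, sum_inner, real_inner_smul_left, sum_inner, chartDiv,
    div_eq_inv_mul]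
  congr 1
  · refine Finset.sum_congr rfl fun i _ => ?_
    rw [hΘ i _ hx, real_inner_smul_left, mul_comm]
  · congr 1
    refine Finset.sum_congr rfl fun i _ => ?_
    have h1 : (fun z => √(metricMatrix g φ z).det * component φ (grad g f) i z) =ᶠ[𝓝 (φ A)]
        fun z => inner ℝ (ρ z • Θ i z) f := by
      filter_upwards [φ.open_target.mem_nhds hx] with z hz
      rw [hΘ i z hz, real_inner_smul_left]
    rw [h1.fderiv_eq,
      ((hρd.fun_smul (hΘd i)).hasFDerivAt.inner ℝ (hasFDerivAt_const f (φ A))).fderiv]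
    simp [e]

end SmoothKernel

/-! ### Rescaled gradients and maximizers on the unit sphere -/

theorem grad_smul {m : ℕ} {M : Type*} [TopologicalSpace M]
    [ChartedSpace (EuclideanSpace ℝ (Fin m)) M] [IsManifold (𝓡 m) ∞ M] (g : RiemannMetric m M)
    {f : M → ℝ} {A : M} (hf : MDifferentiableAt (𝓡 m) 𝓘(ℝ, ℝ) f A) (c : ℝ) :
    grad g (c • f) A = c • grad g f A := by
  have : mfderiv (𝓡 m) 𝓘(ℝ, ℝ) (c • f) A = c • mfderiv (𝓡 m) 𝓘(ℝ, ℝ) f A :=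
    const_smul_mfderiv hf c
  rw [grad, this, grad]
  exact map_smul (ContinuousLinearMap.inverse (g.inner A)) c _

/-- A unit vector that maximizes `inner ℝ F` over the unit sphere, rescaled by the maximum, is
`F`. -/
theorem inner_smul_eq_of_isMax {H : Type*} [NormedAddCommGroup H] [InnerProductSpace ℝ H]
    {F f : H} (hf : ‖f‖ = 1) (hmax : ∀ f' : H, ‖f'‖ = 1 → inner ℝ F f' ≤ inner ℝ F f) :
    inner ℝ F f • f = F := by
  by_cases hF : F = 0
  · simp [hF]
  have hF' : ‖F‖ ≠ 0 := norm_ne_zero_iff.2 hF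
  -- Testing against F/‖F‖ shows that the maximum is at least ‖F‖, so f attains equality in
  -- Cauchy–Schwarz.
  have h1 := hmax (‖F‖⁻¹ • F) (by rw [norm_smul, norm_inv, norm_norm, inv_mul_cancel₀ hF'])
  rw [real_inner_smul_right, real_inner_self_eq_norm_sq, sq, inv_mul_cancel_left₀ hF'] at h1
  have h2 : inner ℝ F f = ‖F‖ :=
    le_antisymm ((real_inner_le_norm F f).trans_eq (by rw [hf, mul_one])) h1
  have h3 := (inner_eq_norm_mul_iff_real (x := F) (y := f)).1 (by rw [h2, hf, mul_one])
  rw [h2, ← h3, hf, one_smul]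

end RSVGD

/-! ### The main theorem -/

theorem proposition6 {m n : ℕ} {M : Type*} [TopologicalSpace M]
    [ChartedSpace (EuclideanSpace ℝ (Fin m)) M] [IsManifold (𝓡 m) ∞ M]
    [MeasurableSpace M] [BorelSpace M]
    -- the Riemannian metric and the isometric embedding
    (g : RSVGD.RiemannMetric m M) (Ξ : M → EuclideanSpace ℝ (Fin n))
    (hΞ : RSVGD.IsIsometricEmbedding g Ξ)
    -- the target density and the particle distribution
    (p : M → ℝ) (hp : ContMDiff (𝓡 m) 𝓘(ℝ, ℝ) ∞ p) (hp_pos : ∀ A, 0 < p A)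
    (q : Measure M) [IsProbabilityMeasure q]
    -- the smooth kernel and its reproducing kernel Hilbert space
    (K : M → M → ℝ)
    (hK : ContMDiff ((𝓡 m).prod (𝓡 m)) 𝓘(ℝ, ℝ) ∞ (fun z : M × M => K z.1 z.2))
    (H : Type*) [NormedAddCommGroup H] [InnerProductSpace ℝ H] [CompleteSpace H]
    [RKHS ℝ H M ℝ] [Nontrivial H]
    (hHK : ∀ A B, RKHS.kernel H A B 1 = K A B)
    -- the objective is well defined on `{grad f | f ∈ H}`
    (hJ : ∀ f : H, Integrable (RSVGD.stein g p (RSVGD.grad g f)) q) :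
    -- `f̂` is a smooth function on the manifold
    ContMDiff (𝓡 m) 𝓘(ℝ, ℝ) ∞ (RSVGD.fHat g p q K) ∧
    -- if zero is the only locally constant function in the space, so that `f ↦ grad f` is
    -- injective on it, then the functional gradient is `X̂ = grad f̂`
    ((∀ f : H, IsLocallyConstant (f : M → ℝ) → f = 0) →
      ∀ X : (A : M) → TangentSpace (𝓡 m) A,
        RSVGD.IsFunctionalGradient g p q H X ↔ X = RSVGD.grad g (RSVGD.fHat g p q K)) ∧
    -- `X̂` in the embedded space
    (∀ (A' : M) (N' : Matrix (Fin n) (Fin (n - m)) ℝ) (h : EuclideanSpace ℝ (Fin n) → ℝ),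
      RSVGD.IsNormalBasis Ξ A' N' →
      RSVGD.IsAmbientExpr Ξ A' (RSVGD.fHat g p q K) h →
      RSVGD.pushforward Ξ (RSVGD.grad g (RSVGD.fHat g p q K)) A' =
        WithLp.toLp 2 ((1 - N' * N'ᵀ) *ᵥ RSVGD.ambGrad h (Ξ A'))) ∧
    -- the formula for `f̂` in the embedded space
    (∀ (A' : M) (φ : M → OpenPartialHomeomorph M (EuclideanSpace ℝ (Fin m)))
      (N : M → Matrix (Fin n) (Fin (n - m)) ℝ) (L k : M → EuclideanSpace ℝ (Fin n) → ℝ)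
      (W : M → EuclideanSpace ℝ (Fin n) → Matrix (Fin m) (Fin n) ℝ),
      (∀ A, φ A ∈ IsManifold.maximalAtlas (𝓡 m) ∞ M ∧ A ∈ (φ A).source) →
      (∀ A, RSVGD.IsNormalBasis Ξ A (N A)) →
      (∀ A, RSVGD.IsAmbientExpr Ξ A
        (fun B => Real.log (p B * √(RSVGD.metricMatrix g (φ A) (φ A B)).det)) (L A)) →
      (∀ A, RSVGD.IsAmbientExpr Ξ A (fun B => K B A') (k A)) →
      (∀ A i β, RSVGD.IsAmbientExpr Ξ A
        (fun B => ((RSVGD.metricMatrix g (φ A) (φ A B))⁻¹ *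
          (RSVGD.jacobian Ξ (φ A) (φ A B))ᵀ) i β) (fun y => W A y i β)) →
      Integrable (fun A => RSVGD.embIntegrand (RSVGD.jacobian Ξ (φ A) (φ A A)) (N A) (L A) (k A)
        (W A) (Ξ A)) q ∧
      RSVGD.fHat g p q K A' =
        ∫ A, RSVGD.embIntegrand (RSVGD.jacobian Ξ (φ A) (φ A A)) (N A) (L A) (k A)
          (W A) (Ξ A) ∂q) := by
  have hstein : ∀ A : M, ∃ s : H, ∀ f : H,
      RSVGD.stein g p (RSVGD.grad g f) A = inner ℝ s f :=
    hΞ.exists_stein_grad_eq_inner hp hp_pos hK hHK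
  choose s hs using hstein
  obtain ⟨F, hF⟩ := RSVGD.exists_inner_eq_integral (q := q) s fun f =>
    (hJ f).congr (Filter.Eventually.of_forall fun A => hs A f)
  have hobj : ∀ f : H, RSVGD.objective g p q (RSVGD.grad g f) = inner ℝ F f := fun f => by
    rw [← hF f]
    exact integral_congr_ae (Filter.Eventually.of_forall fun A => hs A f)
  have hKfun : ∀ A' : M, (fun B => K B A') = (RSVGD.featureMap H A' : H) := fun A' => by
    ext B
    exact (RSVGD.featureMap_apply hHK B A').symm
  -- By definition f̂(A') is the objective at the gradient of the kernel section at A'. The Riesz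
  -- vector paired with that section is its value at A'.
  have hfHat : RSVGD.fHat g p q K = F := by
    ext A'
    change RSVGD.objective g p q (RSVGD.grad g fun B => K B A') = F A'
    rw [hKfun, hobj, real_inner_comm, RSVGD.inner_featureMap]
  have hsmooth := RSVGD.contMDiff_of_contMDiff_kernel (H := H) hK hHK
  have hsmul : ∀ f : H, inner ℝ F f • f = F →
      (fun A => RSVGD.objective g p q (RSVGD.grad g f) • RSVGD.grad g f A) =
        RSVGD.grad g F := by
    intro f hf
    ext1 A
    rw [hobj, ← RSVGD.grad_smul g ((hsmooth f).mdifferentiableAt (by simp)), ← RKHS.coe_smul, hf]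
  refine ⟨hfHat ▸ hsmooth F, fun _ X => ?_, fun A' N' h hN hh => hΞ.pushforward_grad hN hh, ?_⟩
  · rw [hfHat]
    constructor
    · rintro ⟨_, ⟨f, hf, rfl⟩, hmax, rfl⟩
      refine hsmul f (RSVGD.inner_smul_eq_of_isMax hf fun f' hf' => ?_)
      rw [← hobj, ← hobj]
      exact hmax _ ⟨f', hf', rfl⟩
    · rintro rfl
      obtain ⟨f, hf, hmax⟩ : ∃ f : H, ‖f‖ = 1 ∧ ∀ f' : H, ‖f'‖ = 1 →
          inner ℝ F f' ≤ inner ℝ F f := by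
        -- If F = 0 every unit vector is a maximizer, and one exists because `H` is nontrivial;
        -- otherwise F/‖F‖ works.
        by_cases h0 : F = 0
        · obtain ⟨f, hf⟩ := exists_norm_eq H zero_le_one
          exact ⟨f, hf, fun f' _ => by simp [h0]⟩
        · have h0' : ‖F‖ ≠ 0 := norm_ne_zero_iff.2 h0
          refine ⟨‖F‖⁻¹ • F, by rw [norm_smul, norm_inv, norm_norm, inv_mul_cancel₀ h0'],
            fun f' hf' => ?_⟩
          rw [real_inner_smul_right, real_inner_self_eq_norm_sq, sq, inv_mul_cancel_left₀ h0']
          exact (real_inner_le_norm F f').trans_eq (by rw [hf', mul_one])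
      refine ⟨RSVGD.grad g f, ⟨f, hf, rfl⟩, ?_,
        (hsmul f (RSVGD.inner_smul_eq_of_isMax hf hmax)).symm⟩
      rintro _ ⟨f', hf', rfl⟩
      rw [hobj, hobj]
      exact hmax f' hf'
  · intro A' φ N L k W hφ hN hL hk hW
    -- The two integrands agree at every point, whatever the choices of chart, normal basis and
    -- extensions. Integrability therefore transfers from the kernel section, an element of `H`.
    have hpt : ∀ A, RSVGD.stein g p (RSVGD.grad g fun B => K B A') A =
        RSVGD.embIntegrand (RSVGD.jacobian Ξ (φ A) (φ A A)) (N A) (L A) (k A) (W A) (Ξ A) := by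
      intro A
      have hA := (φ A).left_inv (hφ A).2
      have h := hΞ.stein_grad_eq_embIntegrand (hφ A).1 hp hp_pos
        (f := fun B => K B A') (hKfun A' ▸ hsmooth _) ((φ A).map_source (hφ A).2)
        (N := N A) (L := L A) (k := k A) (W := W A)
      simp only [hA] at h
      exact h (hN A) (hL A) (hk A) (hW A)
    have hint := hJ (RSVGD.featureMap H A')
    rw [← hKfun] at hint
    exact ⟨hint.congr (Filter.Eventually.of_forall hpt),
      integral_congr_ae (Filter.Eventually.of_forall hpt)⟩
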